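/- Let $d\ge 1$, let $\Omega\subset\mathbb{R}^d$ be a compact convex set with nonempty interior, and let $\Psi$ be the Matérn kernel $$\Psi(\mathbf{x},\mathbf{x}')=\psi(\|\Theta(\mathbf{x}-\mathbf{x}')\|_2),\qquad \psi(r)=\frac{\sigma^2}{\Gamma(\nu)2^{\nu-1}}(2\sqrt{\nu}\,r)^{\nu}B_\nu(2\sqrt{\nu}\,r)\ (r>0),\qquad \psi(0)=\sigma^2,$$ where $\nu>0$, $\sigma^2>0$, $\Theta$ is a diagonal $d\times d$ matrix with positive diagonal entries, and $B_\nu$ is the modified Bessel function of the second kind. Let $\mathcal{N}_\Psi(\Omega)$ be the reproducing kernel Hilbert space of $\Psi$ on $\Omega$. Let $V$ be a set of continuous functions $\Omega\to\mathbb{R}$ and let $(f(g))_{g\in V}$ be a Gaussian process with mean zero and covariance function (the linear kernel) $$K(g_1,g_2)=\int_\Omega\int_\Omega g_1(\mathbf{x})g_2(\mathbf{x}')\Psi(\mathbf{x},\mathbf{x}')\,d\mathbf{x}\,d\mathbf{x}'.$$ For $n\ge 1$ and knots $\mathbf{X}_n=\{\mathbf{x}_1,\dots,\mathbf{x}_n\}$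 with $\mathbf{x}_j\in\Omega$, put $g_j=\Psi(\cdot,\mathbf{x}_j)$ (assumed to belong to $V$), let $\hat f(g)=\mathbb{E}[f(g)\mid f(g_1),\dots,f(g_n)]$, and let $h_{\mathbf{X}_n,\Omega}=\sup_{\mathbf{x}\in\Omega}\min_{j}\|\mathbf{x}-\mathbf{x}_j\|_2$ be the fill distance. (1) There is a constant $C_3>0$, depending only on $\Omega,\nu,\sigma,\Theta$, such that for all $n\ge 1$, all knots $\mathbf{x}_1,\dots,\mathbf{x}_n\in\Omega$, all such $V$ and $f$, and all $g\in\mathcal{N}_\Psi(\Omega)\cap V$, $$\mathbb{E}\bigl(f(g)-\hat f(g)\bigr)^2\le C_3\,\|g\|^2_{\mathcal{N}_\Psi(\Omega)}\,h_{\mathbf{X}_n,\Omega}^{2\nu}.$$ (2) Call the knots quasi-uniform with constant $c>0$ if $h_{\mathbf{X}_n,\Omega}\le c\,q_{\mathbf{X}_n}$, where $q_{\mathbf{X}_n}=\tfrac12\min_{j\ne k}\|\mathbf{x}_j-\mathbf{x}_k\|_2$ ($q_{\mathbf{X}_n}=\infty$ if $n=1$). For every $c>0$ there are constants $C,C_4>0$,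 depending only on $\Omega,\nu,\sigma,\Theta,c$, such that for all $n\ge 1$ and all knots $\mathbf{x}_1,\dots,\mathbf{x}_n\in\Omega$ that are quasi-uniform with constant $c$, $$h_{\mathbf{X}_n,\Omega}\le C\,n^{-1/d},$$ and, for all such $V$ and $f$ and all $g\in\mathcal{N}_\Psi(\Omega)\cap V$, $$\mathbb{E}\bigl(f(g)-\hat f(g)\bigr)^2\le C_4\,\|g\|^2_{\mathcal{N}_\Psi(\Omega)}\,n^{-2\nu/d}.$$ -/

import Mathlib

open MeasureTheory ProbabilityTheory Set
open scoped InnerProductSpace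

noncomputable section

/-! ### The Matérn kernel -/

/-- The modified Bessel function of the second kind `K_ν(z)`, for real order `ν` and `z > 0`:
`K_ν(z) = ∫₀^∞ exp (-z cosh t) cosh (ν t) dt`. -/
def besselK (ν z : ℝ) : ℝ :=
  ∫ t in Ioi (0 : ℝ), Real.exp (-z * Real.cosh t) * Real.cosh (ν * t)

/-- The parameters of a Matérn kernel on `ℝ^d`: smoothness `ν > 0`, variance `σ² > 0`, and the
positive diagonal scale matrix `Θ = diag (θ₁, …, θ_d)`. -/
structure MaternParams (d : ℕ) where
  ν : ℝ
  σ : ℝ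
  θ : Fin d → ℝ
  ν_pos : 0 < ν
  σ_pos : 0 < σ
  θ_pos : ∀ i, 0 < θ i

/-- The Matérn radial function
`ψ(r) = σ² / (Γ(ν) 2^(ν-1)) (2 √ν r)^ν K_ν(2 √ν r)`, extended to `r = 0` by its limit `σ²`. -/
def maternRadial (ν σ r : ℝ) : ℝ :=
  if r = 0 then σ ^ 2
  else σ ^ 2 / (Real.Gamma ν * 2 ^ (ν - 1)) * (2 * √ν * r) ^ ν * besselK ν (2 * √ν * r)

/-- The linear image `Θ x` of a vector `x` under the diagonal matrix `Θ = diag θ`. -/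
def diagScale {d : ℕ} (θ : Fin d → ℝ) (x : EuclideanSpace ℝ (Fin d)) :
    EuclideanSpace ℝ (Fin d) :=
  WithLp.toLp 2 fun i => θ i * x i

/-- The Matérn kernel `Ψ(x, y) = ψ(‖Θ (x - y)‖₂)`. -/
def matern {d : ℕ} (p : MaternParams d) (x y : EuclideanSpace ℝ (Fin d)) : ℝ :=
  maternRadial p.ν p.σ ‖diagScale p.θ (x - y)‖

/-! ### The Matérn kernel is positive semidefinite -/

lemma integrableOn_gamma_gauss {ν : ℝ} (hν : 0 < ν) {c : ℝ} (hc : 0 ≤ c) :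
    IntegrableOn (fun s : ℝ => s ^ (ν - 1) * Real.exp (-s - c / s)) (Ioi 0) := by
  refine Integrable.mono' (Real.GammaIntegral_convergent hν) ?_ ?_
  · exact (by fun_prop : Measurable fun s : ℝ =>
      s ^ (ν - 1) * Real.exp (-s - c / s)).aestronglyMeasurable
  · refine (ae_restrict_mem measurableSet_Ioi).mono fun s hs => ?_
    have hs : 0 < s := hs
    rw [Real.norm_of_nonneg (by positivity), mul_comm]
    gcongr
    have : 0 ≤ c / s := by positivity
    linarith

lemma rpow_mul_besselK {ν z : ℝ} (hν : 0 < ν) (hz : 0 < z) :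
    z ^ ν * besselK ν z = 2 ^ (ν - 1) *
      ∫ s in Ioi (0 : ℝ), s ^ (ν - 1) * Real.exp (-s - z ^ 2 / 4 / s) := by
  set G : ℝ → ℝ := fun t => Real.exp (-z * Real.cosh t) * Real.exp (ν * t) with hG
  have him : (fun t : ℝ => z / 2 * Real.exp t) '' univ = Ioi 0 := by
    ext s
    simp only [image_univ, mem_range, mem_Ioi]
    constructor
    · rintro ⟨t, rfl⟩; positivity
    · intro hs
      refine ⟨Real.log (2 / z * s), ?_⟩
      rw [Real.exp_log (by positivity)]
      field_simp
  have hder : ∀ t ∈ (univ : Set ℝ), HasDerivWithinAt (fun t : ℝ => z / 2 * Real.exp t)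
      (z / 2 * Real.exp t) univ t := fun t _ =>
    ((Real.hasDerivAt_exp t).const_mul _).hasDerivWithinAt
  have hinj : InjOn (fun t : ℝ => z / 2 * Real.exp t) univ := by
    intro a _ b _ hab
    have hab : z / 2 * Real.exp a = z / 2 * Real.exp b := hab
    exact Real.exp_injective (mul_left_cancel₀ (by positivity) hab)
  have hint := integrableOn_gamma_gauss hν (c := z ^ 2 / 4) (by positivity)
  have hval : ∀ t : ℝ, |z / 2 * Real.exp t| • ((z / 2 * Real.exp t) ^ (ν - 1) *
      Real.exp (-(z / 2 * Real.exp t) - z ^ 2 / 4 / (z / 2 * Real.exp t)))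
      = (z / 2) ^ ν * G t := by
    intro t
    have h0 : 0 < z / 2 * Real.exp t := by positivity
    have h1 : -(z / 2 * Real.exp t) - z ^ 2 / 4 / (z / 2 * Real.exp t) = -z * Real.cosh t := by
      rw [Real.cosh_eq, Real.exp_neg]
      field_simp
      ring
    rw [h1, abs_of_pos h0, smul_eq_mul, ← mul_assoc, ← Real.rpow_one_add' h0.le (by simp; positivity)]
    rw [add_sub_cancel, Real.mul_rpow (by positivity) (by positivity), ← Real.exp_mul, hG,
      mul_comm t ν]
    ring
  have hGint : Integrable G := by
    rw [← him, integrableOn_image_iff_integrableOn_abs_deriv_smul MeasurableSet.univ hder hinj,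
      integrableOn_univ] at hint
    simp_rw [hval] at hint
    refine (hint.const_mul ((z / 2) ^ ν)⁻¹).congr (ae_of_all _ fun t => ?_)
    have : (z / 2) ^ ν ≠ 0 := by positivity
    field_simp
  have hG2 : ∫ t, G t = 2 * besselK ν z := by
    rw [← intervalIntegral.integral_Iic_add_Ioi (b := 0) hGint.integrableOn hGint.integrableOn]
    have h2 : ∫ t in Iic (0 : ℝ), G t = ∫ t in Ioi (0 : ℝ), G (-t) := by
      rw [integral_comp_neg_Ioi]; simp
    rw [h2, ← integral_add hGint.comp_neg.integrableOn hGint.integrableOn, besselK,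
      ← integral_const_mul]
    congr 1
    ext t
    simp only [hG, Real.cosh_neg]
    rw [Real.cosh_eq (ν * t), mul_neg]
    ring
  rw [← him, integral_image_eq_integral_abs_deriv_smul MeasurableSet.univ hder hinj]
  simp_rw [hval]
  rw [setIntegral_univ, integral_const_mul, hG2, Real.div_rpow hz.le (by norm_num),
    Real.rpow_sub_one (by norm_num)]
  field_simp

lemma maternRadial_eq {ν σ r : ℝ} (hν : 0 < ν) (hr : 0 ≤ r) :
    maternRadial ν σ r = σ ^ 2 / Real.Gamma ν *
      ∫ s in Ioi (0 : ℝ), s ^ (ν - 1) * Real.exp (-s - ν * r ^ 2 / s) := by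
  have hΓ := Real.Gamma_pos_of_pos hν
  unfold maternRadial
  split_ifs with h
  · subst h
    have : ∫ s in Ioi (0 : ℝ), s ^ (ν - 1) * Real.exp (-s - ν * 0 ^ 2 / s) = Real.Gamma ν := by
      rw [Real.Gamma_eq_integral hν]
      congr 1
      ext s
      simp [mul_comm]
    rw [this]
    field_simp
  · have hr' : 0 < r := lt_of_le_of_ne hr (Ne.symm h)
    have hz : 0 < 2 * √ν * r := by positivity
    rw [mul_assoc, rpow_mul_besselK hν hz]
    have h4 : (2 * √ν * r) ^ 2 / 4 = ν * r ^ 2 := by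
      rw [mul_pow, mul_pow, Real.sq_sqrt hν.le]; ring
    rw [h4]
    field_simp

lemma gauss_sum_nonneg {d : ℕ} {ι : Type*} (s : Finset ι) (a : ι → ℝ)
    (u : ι → EuclideanSpace ℝ (Fin d)) :
    0 ≤ ∑ i ∈ s, ∑ j ∈ s, a i * a j * Real.exp (-‖u i - u j‖ ^ 2 / 2) := by
  have h : ∀ v : EuclideanSpace ℝ (Fin d), Real.exp (-‖v‖ ^ 2 / 2) =
      ∫ ξ, Real.cos ⟪ξ, v⟫_ℝ ∂(stdGaussian (EuclideanSpace ℝ (Fin d))) := by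
    intro v
    have h1 := charFun_stdGaussian v
    rw [charFun_apply] at h1
    have h2 := congrArg Complex.re h1
    have hint : Integrable (fun ξ : EuclideanSpace ℝ (Fin d) =>
        Complex.exp ((⟪ξ, v⟫_ℝ : ℂ) * Complex.I)) (stdGaussian _) := by
      refine Integrable.of_bound (C := 1) (by fun_prop) (ae_of_all _ fun ξ => ?_)
      rw [Complex.norm_exp_ofReal_mul_I]
    rw [← RCLike.re_eq_complex_re, ← integral_re hint] at h2
    simp only [RCLike.re_eq_complex_re, Complex.exp_ofReal_mul_I_re] at h2
    rw [h2]
    norm_cast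
  have hi : ∀ i j, Integrable (fun ξ : EuclideanSpace ℝ (Fin d) =>
      a i * a j * Real.cos ⟪ξ, u i - u j⟫_ℝ) (stdGaussian _) := by
    intro i j
    refine Integrable.const_mul (Integrable.of_bound (C := 1) (by fun_prop)
      (ae_of_all _ fun ξ => ?_)) _
    exact Real.abs_cos_le_one _
  simp_rw [h, ← integral_const_mul]
  rw [show (∑ i ∈ s, ∑ j ∈ s, ∫ ξ, a i * a j * Real.cos ⟪ξ, u i - u j⟫_ℝ
      ∂(stdGaussian (EuclideanSpace ℝ (Fin d)))) =
      ∫ ξ, ∑ i ∈ s, ∑ j ∈ s, a i * a j * Real.cos ⟪ξ, u i - u j⟫_ℝ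
        ∂(stdGaussian (EuclideanSpace ℝ (Fin d))) from ?_]
  · refine integral_nonneg fun ξ => ?_
    have : (∑ i ∈ s, ∑ j ∈ s, a i * a j * Real.cos ⟪ξ, u i - u j⟫_ℝ) =
        (∑ i ∈ s, a i * Real.cos ⟪ξ, u i⟫_ℝ) ^ 2 +
        (∑ i ∈ s, a i * Real.sin ⟪ξ, u i⟫_ℝ) ^ 2 := by
      rw [sq, sq, Finset.sum_mul_sum, Finset.sum_mul_sum, ← Finset.sum_add_distrib]
      refine Finset.sum_congr rfl fun i _ => ?_
      rw [← Finset.sum_add_distrib]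
      refine Finset.sum_congr rfl fun j _ => ?_
      rw [inner_sub_right, Real.cos_sub]
      ring
    simp only [Pi.zero_apply]
    rw [this]
    positivity
  · rw [integral_finsetSum _ fun i _ => integrable_finsetSum _ fun j _ => hi i j]
    exact Finset.sum_congr rfl fun i _ => (integral_finsetSum _ fun j _ => hi i j).symm

lemma matern_sum_nonneg {d : ℕ} (p : MaternParams d) {ι : Type*} (s : Finset ι) (a : ι → ℝ)
    (x : ι → EuclideanSpace ℝ (Fin d)) :
    0 ≤ ∑ i ∈ s, ∑ j ∈ s, a i * a j * matern p (x i) (x j) := by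
  have hν := p.ν_pos
  have hΓ := Real.Gamma_pos_of_pos hν
  have hi : ∀ i j, IntegrableOn (fun t : ℝ => a i * a j * (t ^ (p.ν - 1) *
      Real.exp (-t - p.ν * ‖diagScale p.θ (x i - x j)‖ ^ 2 / t))) (Ioi 0) := fun i j =>
    (integrableOn_gamma_gauss hν (by positivity)).const_mul _
  have h1 : (∑ i ∈ s, ∑ j ∈ s, a i * a j * matern p (x i) (x j)) = p.σ ^ 2 / Real.Gamma p.ν *
      ∫ t in Ioi (0 : ℝ), ∑ i ∈ s, ∑ j ∈ s, a i * a j * (t ^ (p.ν - 1) *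
      Real.exp (-t - p.ν * ‖diagScale p.θ (x i - x j)‖ ^ 2 / t)) := by
    rw [integral_finsetSum _ fun i _ => integrable_finsetSum _ fun j _ => hi i j,
      Finset.mul_sum]
    refine Finset.sum_congr rfl fun i _ => ?_
    rw [integral_finsetSum _ fun j _ => hi i j, Finset.mul_sum]
    refine Finset.sum_congr rfl fun j _ => ?_
    rw [integral_const_mul, matern, maternRadial_eq hν (norm_nonneg _)]
    ring
  rw [h1]
  refine mul_nonneg (by positivity) (setIntegral_nonneg measurableSet_Ioi fun t ht => ?_)
  have ht : 0 < t := ht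
  have h2 := gauss_sum_nonneg s a fun i => √(2 * p.ν / t) • diagScale p.θ (x i)
  have h3 : (∑ i ∈ s, ∑ j ∈ s, a i * a j * (t ^ (p.ν - 1) *
      Real.exp (-t - p.ν * ‖diagScale p.θ (x i - x j)‖ ^ 2 / t))) =
      t ^ (p.ν - 1) * Real.exp (-t) * ∑ i ∈ s, ∑ j ∈ s, a i * a j * Real.exp
        (-‖√(2 * p.ν / t) • diagScale p.θ (x i) - √(2 * p.ν / t) • diagScale p.θ (x j)‖ ^ 2 / 2) := by
    simp_rw [Finset.mul_sum]
    refine Finset.sum_congr rfl fun i _ => Finset.sum_congr rfl fun j _ => ?_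
    have h4 : diagScale p.θ (x i) - diagScale p.θ (x j) = diagScale p.θ (x i - x j) := by
      ext k; simp [diagScale, mul_sub]
    rw [← smul_sub, h4, norm_smul, mul_pow, Real.norm_of_nonneg (Real.sqrt_nonneg _),
      Real.sq_sqrt (by positivity),
      sub_eq_add_neg (-t) (p.ν * ‖diagScale p.θ (x i - x j)‖ ^ 2 / t), Real.exp_add]
    rw [show -(2 * p.ν / t * ‖diagScale p.θ (x i - x j)‖ ^ 2) / 2 =
      -(p.ν * ‖diagScale p.θ (x i - x j)‖ ^ 2 / t) by ring]
    ring
  rw [h3]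
  positivity

/-! ### The reproducing kernel Hilbert space -/

/-- The Matérn kernel on `Ω × Ω`, each value `Ψ(x, y)` being regarded as the operator
"multiplication by `Ψ(x, y)`" on `ℝ`, which is the form in which Mathlib takes a kernel. -/
def maternKernel {d : ℕ} (p : MaternParams d) (Ω : Set (EuclideanSpace ℝ (Fin d))) :
    Matrix Ω Ω (ℝ →L[ℝ] ℝ) :=
  .of fun x y => matern p x y • ContinuousLinearMap.id ℝ ℝ

lemma matern_comm {d : ℕ} (p : MaternParams d) (x y : EuclideanSpace ℝ (Fin d)) :
    matern p x y = matern p y x := by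
  have h : diagScale p.θ (x - y) = -diagScale p.θ (y - x) := by
    ext k; simp only [diagScale, PiLp.sub_apply, PiLp.neg_apply]; ring
  rw [matern, h, norm_neg, matern]

instance maternKernel_posSemidef {d : ℕ} (p : MaternParams d)
    (Ω : Set (EuclideanSpace ℝ (Fin d))) : Fact (maternKernel p Ω).PosSemidef := by
  refine ⟨((RKHS.posSemidef_tfae (K := maternKernel p Ω)).out 0 2 :).mpr (And.intro ?_ fun v => ?_)⟩
  · ext x y
    simp [maternKernel, matern_comm p x y, Matrix.conjTranspose_apply,
      ← ContinuousLinearMap.one_def]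
  · have := matern_sum_nonneg p v.support v (fun i => (i : EuclideanSpace ℝ (Fin d)))
    simp only [Finsupp.sum, maternKernel, Matrix.of_apply, smul_apply,
      ContinuousLinearMap.id_apply, smul_eq_mul, RCLike.re_to_real]
    refine this.trans_eq (Finset.sum_congr rfl fun i _ => Finset.sum_congr rfl fun j _ => ?_)
    rw [matern_comm p (i : EuclideanSpace ℝ (Fin d))]
    simp only [RCLike.inner_apply, conj_trivial]
    ring

/-- The reproducing kernel Hilbert space `𝓝_Ψ(Ω)` of the Matérn kernel `Ψ` on `Ω`. Its elements
`g` are functions `Ω → ℝ` through the coercion, and `‖g‖` is the norm of `𝓝_Ψ(Ω)`. -/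
abbrev NativeSpace {d : ℕ} (p : MaternParams d) (Ω : Set (EuclideanSpace ℝ (Fin d))) : Type :=
  RKHS.OfKernel (maternKernel p Ω)

/-! ### The functional-input Gaussian process and its mean squared prediction error -/

/-- The linear kernel `K(g₁, g₂) = ∫_Ω ∫_Ω g₁(x) g₂(x') Ψ(x, x') dx dx'` for functional inputs. -/
def linearKernel {d : ℕ} (p : MaternParams d) {Ω : Set (EuclideanSpace ℝ (Fin d))}
    (g₁ g₂ : Ω → ℝ) : ℝ :=
  ∫ x : Ω, ∫ x' : Ω, g₁ x * g₂ x' * matern p x x'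
    ∂(Measure.comap Subtype.val volume) ∂(Measure.comap Subtype.val volume)

/-- `f` is a Gaussian process indexed by the functional space `V`, with mean zero and with the
linear kernel as its covariance function. -/
structure IsLinearFIGP {d : ℕ} (p : MaternParams d) {Ω : Set (EuclideanSpace ℝ (Fin d))}
    (V : Set (Ω → ℝ)) {S : Type*} [MeasurableSpace S] (P : Measure S) (f : V → S → ℝ) : Prop where
  measurable : ∀ g, Measurable (f g)
  gaussian : IsGaussianProcess f P
  mean_zero : ∀ g, ∫ s, f g s ∂P = 0
  cov_eq : ∀ g₁ g₂ : V, covariance (f g₁) (f g₂) P = linearKernel p (g₁ : Ω → ℝ) g₂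

/-- The predictor `f̂(g) = E[f(g) | f(g₁), …, f(g_n)]`. -/
def predictor {V S : Type*} [MeasurableSpace S] (P : Measure S) (f : V → S → ℝ) {n : ℕ}
    (G : Fin n → V) (g : V) : S → ℝ :=
  P[f g | MeasurableSpace.comap (fun s (j : Fin n) => f (G j) s) inferInstance]

/-- The mean squared prediction error `E (f(g) - f̂(g))²`. -/
def mspe {V S : Type*} [MeasurableSpace S] (P : Measure S) (f : V → S → ℝ) {n : ℕ}
    (G : Fin n → V) (g : V) : ℝ :=
  ∫ s, (f g s - predictor P f G g s) ^ 2 ∂P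

/-! ### Designs -/

/-- The input function `x ↦ Ψ(x, y)` attached to a knot `y`. -/
def knotInput {d : ℕ} (p : MaternParams d) {Ω : Set (EuclideanSpace ℝ (Fin d))} (y : Ω) : Ω → ℝ :=
  fun x => matern p x y

/-- The fill distance `sup_{x ∈ Ω} min_j ‖x - x_j‖₂` of a (nonempty) family of knots. -/
def fillDistance {d : ℕ} {Ω : Set (EuclideanSpace ℝ (Fin d))} {n : ℕ} (X : Fin n → Ω) : ℝ :=
  ⨆ x : Ω, ⨅ j : Fin n, ‖(x : EuclideanSpace ℝ (Fin d)) - X j‖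

/-- The knots are quasi-uniform with constant `c`: the fill distance is at most `c` times the
separation distance `q = ½ min_{j ≠ k} ‖x_j - x_k‖₂` (with `q = ∞` for a single knot). -/
def IsQuasiUniform {d : ℕ} {Ω : Set (EuclideanSpace ℝ (Fin d))} {n : ℕ} (c : ℝ)
    (X : Fin n → Ω) : Prop :=
  ∀ j k : Fin n, j ≠ k →
    fillDistance X ≤ c * (‖(X j : EuclideanSpace ℝ (Fin d)) - X k‖ / 2)

end

/-!
The conditional expectation is the `L²`-best predictor, so the mean squared error is at most
`E (f(g) - ∑ a_j f(g_j))² = K(e, e)` with `e = g - ∑ a_j Ψ(·, x_j)`, for every choice of `a`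
(`mspe_le_of_sub_sum_sq_le`). On the compact set `Ω` this is at most a constant times `sup |e|²`.
Take for `∑ a_j Ψ(·, x_j)` the orthogonal projection of `g` in the native space. Then `e` is
orthogonal to every `Ψ(·, x_j)`, and the reproducing property gives `|e(x)| ≤ ‖Ψ(·, x) - v‖ ‖g‖`
for each `v` in the span of the `Ψ(·, x_j)`. It remains to find `v` at distance `O(h^ν)`
(`exists_mem_span_norm_nativeRepresenter_sub_sq_le`).

To this end, reproduce polynomials of degree at most `m`, where `m + 1 > ν`, at `x` from knots at
distance `O(h)` with bounded coefficients. By convexity `Ω` contains a ball of radius comparable to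
`h` near `x`, and in it there are knots close to the scaled copies of fixed unisolvent points;
boundedness of the coefficients follows by compactness, since the generalized Vandermonde
determinant is continuous (`exists_polynomial_reproduction`). The squared distance
`‖Ψ(·, x) - v‖²` is then the quadratic form of `Ψ` at weights `b` that annihilate polynomials of
degree at most `m`. The Matérn kernel being a mixture of the Gaussian kernels
`exp (-ν ‖Θ (x - y)‖² / s)` with weight `s^(ν-1) exp (-s)`, it suffices to treat these. The forms
`∑ b_i b_j ‖Θ (x_i - x_j)‖^(2k)` vanish for `k ≤ m`, because each monomial in the expansion has
degree at most `k` in one of the two points; hence the Gaussian form is `O(min (1, (h²/s)^(m+1)))`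
(`abs_gauss_sum_annihilator_le`), and integration over `s` gives `O(h^(2ν))`
(`matern_sum_annihilator_le`). No Fourier transform or Sobolev space is needed.

For quasi-uniform knots, the balls of radius `h / c` around them are disjoint, and comparing
volumes gives `h = O(n^(-1/d))`.
-/

/-! ### Polynomial reproduction from scattered points -/

/-- A finite family of monomials is unisolvent for suitable points of the unit ball. -/
lemma exists_det_monomial_ne_zero {d : ℕ} (T : Finset (Fin d →₀ ℕ)) :
    ∃ y : T → EuclideanSpace ℝ (Fin d), (∀ i, ‖y i‖ ≤ 1) ∧
      (Matrix.of fun i s : T =>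
        MvPolynomial.eval (y i).ofLp (MvPolynomial.monomial s.1 (1 : ℝ))).det ≠ 0 := by
  classical
  set φ : EuclideanSpace ℝ (Fin d) → T → ℝ := fun z s =>
    MvPolynomial.eval z.ofLp (MvPolynomial.monomial s.1 (1 : ℝ)) with hφ
  have hspan : ⊤ ≤ Submodule.span ℝ (φ '' Metric.closedBall 0 1) := by
    by_contra hne
    obtain ⟨ℓ, hℓ, hker⟩ := Submodule.exists_le_ker_of_lt_top _
      (lt_top_iff_ne_top.mpr fun h => hne h.ge)
    set c : T → ℝ := fun s => ℓ (Pi.single s 1) with hc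
    have hℓc : ∀ v : T → ℝ, ℓ v = ∑ s, c s * v s := by
      intro v
      conv_lhs => rw [← Finset.univ_sum_single v]
      rw [map_sum]
      refine Finset.sum_congr rfl fun s _ => ?_
      rw [show Pi.single s (v s) = v s • (Pi.single s 1 : T → ℝ) by
        rw [← Pi.single_smul, smul_eq_mul, mul_one], map_smul, smul_eq_mul, mul_comm]
    set q : MvPolynomial (Fin d) ℝ := ∑ s : T, MvPolynomial.monomial s.1 (c s) with hq
    have heval : ∀ z : EuclideanSpace ℝ (Fin d), MvPolynomial.eval z.ofLp q = ℓ (φ z) := by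
      intro z
      rw [hℓc, hq, map_sum]
      refine Finset.sum_congr rfl fun s _ => ?_
      simp [hφ, MvPolynomial.eval_monomial]
    -- The unit ball contains a neighbourhood of `0`, hence a cube, on which `q` vanishes.
    have hq0 : q = 0 := by
      obtain ⟨δ, hδ, hball⟩ := Metric.mem_nhds_iff.mp
        ((PiLp.continuous_toLp 2 (fun _ : Fin d => ℝ)).continuousAt.preimage_mem_nhds
          (x := (0 : Fin d → ℝ)) (t := Metric.closedBall 0 1)
          (by simpa using Metric.closedBall_mem_nhds _ one_pos))
      refine MvPolynomial.funext_set (fun _ : Fin d => Metric.ball (0 : ℝ) δ)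
        (fun _ => infinite_of_mem_nhds 0 (Metric.ball_mem_nhds _ hδ)) fun x hx => ?_
      have hxb : x ∈ Metric.ball (0 : Fin d → ℝ) δ := by
        rw [ball_pi _ hδ]
        exact fun i _ => hx i (mem_univ i)
      have h1 : φ (WithLp.toLp 2 x) ∈ LinearMap.ker ℓ :=
        hker (Submodule.subset_span (mem_image_of_mem _ (hball hxb)))
      rw [map_zero, show x = (WithLp.toLp 2 x).ofLp from rfl, heval]
      exact h1
    refine hℓ (LinearMap.ext fun v => ?_)
    rw [hℓc]
    refine Finset.sum_eq_zero fun s _ => ?_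
    have : MvPolynomial.coeff s.1 q = c s := by
      rw [hq, MvPolynomial.coeff_sum]
      simp [MvPolynomial.coeff_monomial]
    rw [← this, hq0]
    simp
  set b := Module.Basis.ofSpan hspan with hb
  set e := (Pi.basisFun ℝ T).indexEquiv b with he
  have hmem : ∀ i, ∃ z ∈ Metric.closedBall (0 : EuclideanSpace ℝ (Fin d)) 1, φ z = b (e i) :=
    fun i => Module.Basis.ofSpan_subset hspan (mem_range_self (e i))
  choose y hy hyb using hmem
  refine ⟨y, fun i => by simpa using hy i, ?_⟩
  have hli : LinearIndependent ℝ (Matrix.of fun i s : T => φ (y i) s).row := by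
    have : (Matrix.of fun i s : T => φ (y i) s).row = b ∘ e := by
      funext i
      exact hyb i
    rw [this]
    exact b.linearIndependent.comp _ e.injective
  exact ((Matrix.isUnit_iff_isUnit_det _).mp
    (Matrix.linearIndependent_rows_iff_isUnit.mp hli)).ne_zero

/-- **Local polynomial reproduction.** There are finitely many reference points in the unit ball
such that, whenever each of them is moved by at most `ε`, evaluation at any `w` with `‖w‖ ≤ R` is,
on polynomials of degree at most `m`, a combination of the evaluations at the moved points, with
coefficients bounded uniformly. -/
lemma exists_polynomial_reproduction (d m : ℕ) (R : ℝ) :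
    ∃ (ι : Type) (_ : Fintype ι) (y : ι → EuclideanSpace ℝ (Fin d)) (ε A : ℝ),
      (∀ i, ‖y i‖ ≤ 1) ∧ 0 < ε ∧ ε ≤ 1 ∧
      ∀ z : ι → EuclideanSpace ℝ (Fin d), (∀ i, ‖z i - y i‖ ≤ ε) →
      ∀ w : EuclideanSpace ℝ (Fin d), ‖w‖ ≤ R → ∃ a : ι → ℝ, ∑ i, |a i| ≤ A ∧
        ∀ q : MvPolynomial (Fin d) ℝ, q.totalDegree ≤ m →
          ∑ i, a i * MvPolynomial.eval (z i).ofLp q = MvPolynomial.eval w.ofLp q := by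
  classical
  set T : Finset (Fin d →₀ ℕ) := (Finsupp.finite_of_degree_le m).toFinset with hT
  obtain ⟨y, hy1, hdet⟩ := exists_det_monomial_ne_zero T
  set φ : EuclideanSpace ℝ (Fin d) → T → ℝ := fun z s =>
    MvPolynomial.eval z.ofLp (MvPolynomial.monomial s.1 (1 : ℝ)) with hφ
  have hφc : Continuous φ := by
    refine continuous_pi fun s => ?_
    exact (MvPolynomial.continuous_eval _).comp (PiLp.continuous_ofLp 2 _)
  set M : (T → EuclideanSpace ℝ (Fin d)) → Matrix T T ℝ := fun z => .of fun i s => φ (z i) s with hM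
  have hMc : Continuous M := continuous_matrix fun i s =>
    (continuous_apply s).comp (hφc.comp (continuous_apply i))
  have hopen : {z | (M z).det ≠ 0} ∈ nhds y :=
    (isOpen_ne_fun hMc.matrix_det continuous_const).mem_nhds hdet
  obtain ⟨δ, hδ, hball⟩ := Metric.nhds_basis_closedBall.mem_iff.mp hopen
  set F : (T → EuclideanSpace ℝ (Fin d)) × EuclideanSpace ℝ (Fin d) → T → ℝ := fun zw =>
    (M zw.1).det⁻¹ • (Matrix.vecMul (φ zw.2) (M zw.1).adjugate) with hF
  have hM1 : Continuous fun zw : (T → EuclideanSpace ℝ (Fin d)) × EuclideanSpace ℝ (Fin d) =>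
      M zw.1 := hMc.comp continuous_fst
  have hφ2 : Continuous fun zw : (T → EuclideanSpace ℝ (Fin d)) × EuclideanSpace ℝ (Fin d) =>
      φ zw.2 := hφc.comp continuous_snd
  obtain ⟨B, hB⟩ := ((isCompact_closedBall y δ).prod
    (isCompact_closedBall (0 : EuclideanSpace ℝ (Fin d)) R)).exists_bound_of_continuousOn (f := F) (by
      refine ContinuousOn.smul (ContinuousOn.inv₀ (Continuous.continuousOn
        (Continuous.matrix_det hM1)) fun zw hzw => hball hzw.1) ?_
      exact Continuous.continuousOn (Continuous.matrix_vecMul hφ2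
        (Continuous.matrix_adjugate hM1)))
  refine ⟨T, inferInstance, y, min δ 1, Fintype.card T * B, hy1, lt_min hδ one_pos,
    min_le_right _ _, fun z hz w hw => ⟨F (z, w), ?_, ?_⟩⟩
  · have hmem : (z, w) ∈ Metric.closedBall y δ ×ˢ Metric.closedBall 0 R := by
      refine ⟨?_, by simpa using hw⟩
      refine (dist_pi_le_iff hδ.le).mpr fun i => ?_
      rw [dist_eq_norm]
      exact (hz i).trans (min_le_left _ _)
    calc ∑ i, |F (z, w) i| ≤ ∑ _i : T, B :=
          Finset.sum_le_sum fun i _ => (norm_le_pi_norm (F (z, w)) i).trans (hB _ hmem)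
      _ = Fintype.card T * B := by simp
  · intro q hq
    have hdz : (M z).det ≠ 0 := hball ((dist_pi_le_iff hδ.le).mpr fun i => by
      rw [dist_eq_norm]
      exact (hz i).trans (min_le_left _ _))
    have hmul : Matrix.vecMul (F (z, w)) (M z) = φ w := by
      simp only [hF]
      rw [Matrix.smul_vecMul, Matrix.vecMul_vecMul, Matrix.adjugate_mul, Matrix.vecMul_smul,
        Matrix.vecMul_one, smul_smul, inv_mul_cancel₀ hdz, one_smul]
    have hsupp : q.support ⊆ T := fun s hs => by
      rw [hT, Set.Finite.mem_toFinset]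
      exact (MvPolynomial.le_totalDegree hs).trans hq
    have hexp : ∀ u : EuclideanSpace ℝ (Fin d),
        MvPolynomial.eval u.ofLp q = ∑ s : T, MvPolynomial.coeff s.1 q * φ u s := by
      intro u
      rw [MvPolynomial.eval_eq, Finset.sum_subset hsupp fun s _ hs => by
        rw [MvPolynomial.notMem_support_iff.mp hs, zero_mul], ← Finset.sum_coe_sort T]
      refine Finset.sum_congr rfl fun s _ => ?_
      simp [hφ, MvPolynomial.eval_monomial, Finsupp.prod]
    simp_rw [hexp, Finset.mul_sum]
    rw [Finset.sum_comm]
    refine Finset.sum_congr rfl fun s _ => ?_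
    have := congrFun hmul s
    simp only [Matrix.vecMul, dotProduct, hM, Matrix.of_apply] at this
    rw [← this, Finset.mul_sum]
    exact Finset.sum_congr rfl fun i _ => by ring

/-! ### Weights annihilating polynomials -/

/-- If the weights `b` at the points `z` annihilate the polynomials of degree at most `m`, the
quadratic form `∑ b_i b_j ‖Θ (z_i - z_j)‖^(2k)` vanishes for `k ≤ m`: every monomial of degree `2k`
in the pair `(z_i, z_j)` has degree at most `k` in one of the two variables. -/
lemma sum_annihilator_norm_pow_eq_zero {d m : ℕ} (θ : Fin d → ℝ) {κ : Type*} [Fintype κ]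
    (b : κ → ℝ) (z : κ → EuclideanSpace ℝ (Fin d))
    (hb : ∀ q : MvPolynomial (Fin d) ℝ, q.totalDegree ≤ m →
      ∑ i, b i * MvPolynomial.eval (z i).ofLp q = 0) {k : ℕ} (hk : k ≤ m) :
    ∑ i, ∑ j, b i * b j * (‖diagScale θ (z i - z j)‖ ^ 2) ^ k = 0 := by
  set N : EuclideanSpace ℝ (Fin d) → ℝ := fun u => ∑ l, θ l ^ 2 * u l ^ 2 with hN
  set B : EuclideanSpace ℝ (Fin d) → EuclideanSpace ℝ (Fin d) → ℝ :=
    fun u v => ∑ l, θ l ^ 2 * v l * u l with hB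
  have hBcomm : ∀ u v, B u v = B v u := fun u v => Finset.sum_congr rfl fun l _ => by ring
  have hD : ∀ u v, ‖diagScale θ (u - v)‖ ^ 2 = N u + N v - 2 * B u v := by
    intro u v
    rw [EuclideanSpace.real_norm_sq_eq, hN, hB]
    simp only
    rw [Finset.mul_sum, ← Finset.sum_add_distrib, ← Finset.sum_sub_distrib]
    refine Finset.sum_congr rfl fun l _ => ?_
    simp only [diagScale, PiLp.sub_apply]
    ring
  have hvar : ∀ (α β γ : ℕ), α + β + γ ≤ m → α ≤ β → ∀ v : EuclideanSpace ℝ (Fin d),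
      ∑ i, b i * (N (z i) ^ α * B (z i) v ^ γ) = 0 := by
    intro α β γ h1 h2 v
    set qN : MvPolynomial (Fin d) ℝ := ∑ l, MvPolynomial.C (θ l ^ 2) * MvPolynomial.X l ^ 2 with hqN
    set qB : MvPolynomial (Fin d) ℝ :=
      ∑ l, MvPolynomial.C (θ l ^ 2 * v l) * MvPolynomial.X l with hqB
    have hdN : qN.totalDegree ≤ 2 := MvPolynomial.totalDegree_finsetSum_le fun l _ =>
      (MvPolynomial.totalDegree_mul _ _).trans (by
        rw [MvPolynomial.totalDegree_C, MvPolynomial.totalDegree_X_pow])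
    have hdB : qB.totalDegree ≤ 1 := MvPolynomial.totalDegree_finsetSum_le fun l _ =>
      (MvPolynomial.totalDegree_mul _ _).trans (by
        rw [MvPolynomial.totalDegree_C, MvPolynomial.totalDegree_X])
    have hdeg : (qN ^ α * qB ^ γ).totalDegree ≤ m := by
      refine (MvPolynomial.totalDegree_mul _ _).trans ?_
      have h3 := (MvPolynomial.totalDegree_pow qN α).trans (Nat.mul_le_mul_left α hdN)
      have h4 := (MvPolynomial.totalDegree_pow qB γ).trans (Nat.mul_le_mul_left γ hdB)
      omega
    rw [← hb _ hdeg]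
    refine Finset.sum_congr rfl fun i _ => ?_
    simp [hqN, hqB, hN, hB]
  have hmon : ∀ α β γ : ℕ, α + β + γ ≤ m →
      ∑ i, ∑ j, b i * b j * (N (z i) ^ α * N (z j) ^ β * B (z i) (z j) ^ γ) = 0 := by
    intro α β γ h
    rcases le_total α β with h1 | h1
    · rw [Finset.sum_comm]
      refine Finset.sum_eq_zero fun j _ => ?_
      rw [show ∑ i, b i * b j * (N (z i) ^ α * N (z j) ^ β * B (z i) (z j) ^ γ) =
        b j * N (z j) ^ β * ∑ i, b i * (N (z i) ^ α * B (z i) (z j) ^ γ) by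
          rw [Finset.mul_sum]; exact Finset.sum_congr rfl fun i _ => by ring,
        hvar α β γ h h1, mul_zero]
    · refine Finset.sum_eq_zero fun i _ => ?_
      rw [show ∑ j, b i * b j * (N (z i) ^ α * N (z j) ^ β * B (z i) (z j) ^ γ) =
        b i * N (z i) ^ α * ∑ j, b j * (N (z j) ^ β * B (z j) (z i) ^ γ) by
          rw [Finset.mul_sum]
          exact Finset.sum_congr rfl fun j _ => by rw [hBcomm (z i)]; ring,
        hvar β α γ (by omega) h1, mul_zero]
  set G : ℕ → ℕ → ℕ → ℕ → ℝ := fun n α β γ => ∑ i, ∑ j, b i * b j *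
    (N (z i) ^ α * N (z j) ^ β * B (z i) (z j) ^ γ * (‖diagScale θ (z i - z j)‖ ^ 2) ^ n) with hG
  have hgen : ∀ n α β γ : ℕ, α + β + γ + n ≤ m → G n α β γ = 0 := by
    intro n
    induction n with
    | zero => intro α β γ h; simpa [hG] using hmon α β γ h
    | succ n ih =>
      intro α β γ h
      have hrec : G (n + 1) α β γ =
          G n (α + 1) β γ + G n α (β + 1) γ - 2 * G n α β (γ + 1) := by
        simp only [hG]
        rw [Finset.mul_sum, ← Finset.sum_add_distrib, ← Finset.sum_sub_distrib]
        refine Finset.sum_congr rfl fun i _ => ?_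
        rw [Finset.mul_sum, ← Finset.sum_add_distrib, ← Finset.sum_sub_distrib]
        refine Finset.sum_congr rfl fun j _ => ?_
        rw [pow_succ (‖diagScale θ (z i - z j)‖ ^ 2) n]
        nth_rw 2 [hD (z i) (z j)]
        ring
      rw [hrec, ih _ _ _ (by omega), ih _ _ _ (by omega), ih _ _ _ (by omega)]
      ring
  simpa [hG] using hgen k 0 0 0 (by omega)

lemma abs_sum_sum_mul_le {κ : Type*} [Fintype κ] (b : κ → ℝ) {A : ℝ} (hA : ∑ i, |b i| ≤ A)
    (f : κ → κ → ℝ) {c : ℝ} (hc : 0 ≤ c) (hf : ∀ i j, |f i j| ≤ c) :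
    |∑ i, ∑ j, b i * b j * f i j| ≤ A ^ 2 * c := by
  calc |∑ i, ∑ j, b i * b j * f i j| ≤ ∑ i, ∑ j, |b i| * |b j| * c := by
        refine (Finset.abs_sum_le_sum_abs _ _).trans (Finset.sum_le_sum fun i _ => ?_)
        refine (Finset.abs_sum_le_sum_abs _ _).trans (Finset.sum_le_sum fun j _ => ?_)
        rw [abs_mul, abs_mul]
        gcongr
        exact hf i j
    _ = (∑ i, |b i|) ^ 2 * c := by
        rw [sq, Finset.sum_mul_sum, Finset.sum_mul]
        exact Finset.sum_congr rfl fun i _ => by rw [Finset.sum_mul]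
    _ ≤ A ^ 2 * c := by
        have : 0 ≤ ∑ i, |b i| := Finset.sum_nonneg fun i _ => abs_nonneg _
        gcongr

/-- The quadratic form of the Gaussian kernel `exp (-t ‖Θ (u - v)‖²)` is `O(t^(m+1))` on weights
that annihilate the polynomials of degree at most `m`: the first `m + 1` terms of the exponential
series cancel. -/
lemma abs_gauss_sum_annihilator_le {d m : ℕ} (θ : Fin d → ℝ) {κ : Type*} [Fintype κ]
    (b : κ → ℝ) (z : κ → EuclideanSpace ℝ (Fin d))
    (hb : ∀ q : MvPolynomial (Fin d) ℝ, q.totalDegree ≤ m →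
      ∑ i, b i * MvPolynomial.eval (z i).ofLp q = 0) {A D t : ℝ} (hA : ∑ i, |b i| ≤ A)
    (hD : ∀ i j, ‖diagScale θ (z i - z j)‖ ^ 2 ≤ D) (hD0 : 0 ≤ D) (ht : 0 ≤ t) :
    |∑ i, ∑ j, b i * b j * Real.exp (-(t * ‖diagScale θ (z i - z j)‖ ^ 2))| ≤
      A ^ 2 * (2 * (t * D) ^ (m + 1)) := by
  set x : κ → κ → ℝ := fun i j => t * ‖diagScale θ (z i - z j)‖ ^ 2 with hx
  have hx0 : ∀ i j, 0 ≤ x i j := fun i j => by positivity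
  have hxD : ∀ i j, x i j ≤ t * D := fun i j => mul_le_mul_of_nonneg_left (hD i j) ht
  by_cases h1 : t * D ≤ 1
  · have hpoly : ∑ i, ∑ j, b i * b j * ∑ k ∈ Finset.range (m + 1),
        (-(x i j)) ^ k / (k.factorial : ℝ) = 0 := by
      simp_rw [Finset.mul_sum]
      rw [show ∑ i, ∑ j, ∑ k ∈ Finset.range (m + 1),
          b i * b j * ((-(x i j)) ^ k / (k.factorial : ℝ)) =
        ∑ k ∈ Finset.range (m + 1), (-t) ^ k / (k.factorial : ℝ) *
          ∑ i, ∑ j, b i * b j * (‖diagScale θ (z i - z j)‖ ^ 2) ^ k from ?_]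
      · refine Finset.sum_eq_zero fun k hk => ?_
        rw [sum_annihilator_norm_pow_eq_zero θ b z hb (Nat.lt_succ_iff.mp (Finset.mem_range.mp hk)),
          mul_zero]
      · rw [Finset.sum_congr rfl fun i _ => Finset.sum_comm, Finset.sum_comm]
        refine Finset.sum_congr rfl fun k _ => ?_
        rw [Finset.mul_sum]
        refine Finset.sum_congr rfl fun i _ => ?_
        rw [Finset.mul_sum]
        refine Finset.sum_congr rfl fun j _ => ?_
        simp only [hx]
        rw [show -(t * ‖diagScale θ (z i - z j)‖ ^ 2) = -t * ‖diagScale θ (z i - z j)‖ ^ 2 by ring,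
          mul_pow (-t)]
        ring
    have hsub : ∑ i, ∑ j, b i * b j * Real.exp (-(x i j)) = ∑ i, ∑ j, b i * b j *
        (Real.exp (-(x i j)) - ∑ k ∈ Finset.range (m + 1), (-(x i j)) ^ k / (k.factorial : ℝ)) := by
      simp_rw [mul_sub, Finset.sum_sub_distrib]
      rw [hpoly, sub_zero]
    rw [hsub]
    refine abs_sum_sum_mul_le b hA _ (by positivity) fun i j => ?_
    refine (Real.exp_bound (by rw [abs_neg, abs_of_nonneg (hx0 i j)]; exact (hxD i j).trans h1)
      m.succ_pos).trans ?_
    rw [abs_neg, abs_of_nonneg (hx0 i j), mul_comm]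
    have hc : ((m + 1).succ : ℝ) / ((m + 1).factorial * (m + 1 : ℕ)) ≤ 2 := by
      have hf : (1 : ℝ) ≤ (m + 1).factorial := by exact_mod_cast Nat.factorial_pos _
      rw [div_le_iff₀ (by positivity)]
      push_cast
      have hm : (0 : ℝ) ≤ m := m.cast_nonneg
      nlinarith
    have hp := pow_le_pow_left₀ (hx0 i j) (hxD i j) (m + 1)
    have : 0 ≤ x i j ^ (m + 1) := pow_nonneg (hx0 i j) _
    gcongr
  · have h2 : 1 ≤ (t * D) ^ (m + 1) := one_le_pow₀ (not_le.mp h1).le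
    refine abs_sum_sum_mul_le b hA _ (by positivity) fun i j => ?_
    rw [abs_of_pos (Real.exp_pos _)]
    have := Real.exp_le_one_iff.mpr (neg_nonpos.mpr (hx0 i j))
    linarith

/-! ### The Matérn quadratic form on annihilating weights -/

/-- An integrand bounded by `s^(ν-1) min (A, B (ρ/s)^μ)` with `μ > ν` has integral `O(ρ^ν)`: the
range of integration is split at `s = ρ`. -/
lemma setIntegral_Ioi_zero_le_of_le_rpow {ν μ ρ A B : ℝ} (hν : 0 < ν) (hμ : ν < μ) (hρ : 0 < ρ)
    {f : ℝ → ℝ} (hf : IntegrableOn f (Ioi 0))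
    (h1 : ∀ s, 0 < s → f s ≤ A * s ^ (ν - 1))
    (h2 : ∀ s, 0 < s → f s ≤ B * (s ^ (ν - 1) * (ρ / s) ^ μ)) :
    ∫ s in Ioi 0, f s ≤ (A / ν + B / (μ - ν)) * ρ ^ ν := by
  rw [← Ioc_union_Ioi_eq_Ioi hρ.le, setIntegral_union Ioc_disjoint_Ioi_same measurableSet_Ioi
    (hf.mono_set Ioc_subset_Ioi_self) (hf.mono_set (Ioi_subset_Ioi hρ.le))]
  have hi1 : IntegrableOn (fun s : ℝ => A * s ^ (ν - 1)) (Ioc 0 ρ) := by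
    rw [← intervalIntegrable_iff_integrableOn_Ioc_of_le hρ.le]
    exact (intervalIntegral.intervalIntegrable_rpow' (by linarith)).const_mul A
  have hi2 : IntegrableOn (fun s : ℝ => B * ρ ^ μ * s ^ (ν - 1 - μ)) (Ioi ρ) :=
    (integrableOn_Ioi_rpow_of_lt (by linarith) hρ).const_mul _
  have e1 : ∫ s in Ioc 0 ρ, f s ≤ A / ν * ρ ^ ν := by
    refine (setIntegral_mono_on (hf.mono_set Ioc_subset_Ioi_self) hi1 measurableSet_Ioc
      fun s hs => h1 s hs.1).trans_eq ?_
    rw [← intervalIntegral.integral_of_le hρ.le, intervalIntegral.integral_const_mul,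
      integral_rpow (Or.inl (by linarith)), sub_add_cancel, Real.zero_rpow hν.ne']
    ring
  have e2 : ∫ s in Ioi ρ, f s ≤ B / (μ - ν) * ρ ^ ν := by
    refine (setIntegral_mono_on (hf.mono_set (Ioi_subset_Ioi hρ.le)) hi2 measurableSet_Ioi
      fun s hs => (h2 s (hρ.trans hs)).trans_eq ?_).trans_eq ?_
    · have hs : 0 < s := hρ.trans hs
      rw [Real.div_rpow hρ.le hs.le, Real.rpow_sub hs (ν - 1) μ]
      ring
    · rw [integral_const_mul, integral_Ioi_rpow_of_lt (by linarith) hρ,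
        show ν - 1 - μ + 1 = ν - μ by ring, Real.rpow_sub hρ]
      have : μ - ν ≠ 0 := by linarith
      have : ν - μ ≠ 0 := by linarith
      have : ρ ^ μ ≠ 0 := by positivity
      field_simp
      ring
  calc _ ≤ A / ν * ρ ^ ν + B / (μ - ν) * ρ ^ ν := add_le_add e1 e2
    _ = _ := by ring

lemma diagScale_smul {d : ℕ} (θ : Fin d → ℝ) (r : ℝ) (u : EuclideanSpace ℝ (Fin d)) :
    diagScale θ (r • u) = r • diagScale θ u := by
  ext k
  simp only [diagScale, PiLp.smul_apply, smul_eq_mul]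
  ring

/-- On weights annihilating the polynomials of degree at most `m > ν - 1`, at points which are a
copy of `z` scaled by `r`, the Matérn quadratic form is `O(r^(2ν))`. The kernel is a mixture of
Gaussians, and the bound `min (1, (r²/s)^(m+1))` for the Gaussian of scale `s` is integrated
against `s^(ν-1) exp (-s)`. -/
lemma matern_sum_annihilator_le {d m : ℕ} (p : MaternParams d) (hm : p.ν < (m + 1 : ℕ))
    {κ : Type*} [Fintype κ] (b : κ → ℝ) (z : κ → EuclideanSpace ℝ (Fin d))
    (hb : ∀ q : MvPolynomial (Fin d) ℝ, q.totalDegree ≤ m →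
      ∑ i, b i * MvPolynomial.eval (z i).ofLp q = 0) {A D r : ℝ} (hA : ∑ i, |b i| ≤ A)
    (hD : ∀ i j, ‖diagScale p.θ (z i - z j)‖ ^ 2 ≤ D) (hD0 : 0 < D) (hr : 0 < r)
    (x : κ → EuclideanSpace ℝ (Fin d)) (hx : ∀ i j, x i - x j = r • (z i - z j)) :
    ∑ i, ∑ j, b i * b j * matern p (x i) (x j) ≤
      p.σ ^ 2 / Real.Gamma p.ν * ((A ^ 2 / p.ν + 2 * A ^ 2 / ((m + 1 : ℕ) - p.ν)) *
        (p.ν * D) ^ p.ν) * r ^ (2 * p.ν) := by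
  have hν := p.ν_pos
  have hΓ := Real.Gamma_pos_of_pos hν
  have hi : ∀ i j, IntegrableOn (fun s : ℝ => b i * b j * (s ^ (p.ν - 1) *
      Real.exp (-s - p.ν * ‖diagScale p.θ (x i - x j)‖ ^ 2 / s))) (Ioi 0) := fun i j =>
    (integrableOn_gamma_gauss hν (by positivity)).const_mul _
  have h1 : (∑ i, ∑ j, b i * b j * matern p (x i) (x j)) = p.σ ^ 2 / Real.Gamma p.ν *
      ∫ s in Ioi (0 : ℝ), ∑ i, ∑ j, b i * b j * (s ^ (p.ν - 1) *
      Real.exp (-s - p.ν * ‖diagScale p.θ (x i - x j)‖ ^ 2 / s)) := by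
    rw [integral_finsetSum _ fun i _ => integrable_finsetSum _ fun j _ => hi i j, Finset.mul_sum]
    refine Finset.sum_congr rfl fun i _ => ?_
    rw [integral_finsetSum _ fun j _ => hi i j, Finset.mul_sum]
    refine Finset.sum_congr rfl fun j _ => ?_
    rw [integral_const_mul, matern, maternRadial_eq hν (norm_nonneg _)]
    ring
  have hint : IntegrableOn (fun s : ℝ => ∑ i, ∑ j, b i * b j * (s ^ (p.ν - 1) *
      Real.exp (-s - p.ν * ‖diagScale p.θ (x i - x j)‖ ^ 2 / s))) (Ioi 0) :=
    integrable_finsetSum _ fun i _ => integrable_finsetSum _ fun j _ => hi i j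
  have hQ : ∀ s : ℝ, 0 < s → (∑ i, ∑ j, b i * b j * (s ^ (p.ν - 1) *
      Real.exp (-s - p.ν * ‖diagScale p.θ (x i - x j)‖ ^ 2 / s))) =
      s ^ (p.ν - 1) * Real.exp (-s) * ∑ i, ∑ j, b i * b j *
        Real.exp (-(p.ν * r ^ 2 / s * ‖diagScale p.θ (z i - z j)‖ ^ 2)) := by
    intro s hs
    simp_rw [Finset.mul_sum]
    refine Finset.sum_congr rfl fun i _ => Finset.sum_congr rfl fun j _ => ?_
    rw [hx, diagScale_smul, norm_smul, mul_pow, Real.norm_eq_abs, sq_abs, sub_eq_add_neg (-s),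
      Real.exp_add, show p.ν * (r ^ 2 * ‖diagScale p.θ (z i - z j)‖ ^ 2) / s =
        p.ν * r ^ 2 / s * ‖diagScale p.θ (z i - z j)‖ ^ 2 by ring]
    ring
  have hle : ∀ s Q : ℝ, ∀ c : ℝ, 0 < s → |Q| ≤ c → s ^ (p.ν - 1) * Real.exp (-s) * Q ≤
      c * s ^ (p.ν - 1) := by
    intro s Q c hs hc
    have h0 : 0 < s ^ (p.ν - 1) := by positivity
    have he : Real.exp (-s) ≤ 1 := Real.exp_le_one_iff.mpr (by linarith)
    have : Real.exp (-s) * Q ≤ c :=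
      calc Real.exp (-s) * Q ≤ Real.exp (-s) * |Q| := by gcongr; exact le_abs_self Q
        _ ≤ 1 * |Q| := by gcongr
        _ ≤ c := by linarith
    calc s ^ (p.ν - 1) * Real.exp (-s) * Q = (Real.exp (-s) * Q) * s ^ (p.ν - 1) := by ring
      _ ≤ c * s ^ (p.ν - 1) := by gcongr
  have hmain := setIntegral_Ioi_zero_le_of_le_rpow (ρ := p.ν * D * r ^ 2) (μ := (m + 1 : ℕ))
    (A := A ^ 2) (B := 2 * A ^ 2) hν hm (by positivity) hint
    (fun s hs => by
      rw [hQ s hs]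
      refine hle s _ _ hs ?_
      refine (abs_sum_sum_mul_le b hA _ zero_le_one fun i j => ?_).trans_eq (mul_one _)
      rw [abs_of_pos (Real.exp_pos _)]
      exact Real.exp_le_one_iff.mpr (neg_nonpos.mpr (by positivity)))
    (fun s hs => by
      rw [hQ s hs]
      refine (hle s _ _ hs (abs_gauss_sum_annihilator_le p.θ b z hb hA hD hD0.le
        (by positivity))).trans_eq ?_
      rw [Real.rpow_natCast, show p.ν * r ^ 2 / s * D = p.ν * D * r ^ 2 / s by ring]
      ring)
  rw [h1]
  refine (mul_le_mul_of_nonneg_left hmain (by positivity)).trans_eq ?_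
  have hpow : (p.ν * D * r ^ 2) ^ p.ν = (p.ν * D) ^ p.ν * r ^ (2 * p.ν) := by
    rw [Real.mul_rpow (by positivity) (by positivity), ← Real.rpow_natCast r 2,
      ← Real.rpow_mul hr.le]
    norm_num
  rw [hpow]
  ring

/-! ### Distances to the span of the kernel functions at the knots -/

/-- The representer `Ψ(·, x)` of evaluation at `x` in the native space. -/
noncomputable def nativeRepresenter {d : ℕ} (p : MaternParams d) {Ω : Set (EuclideanSpace ℝ (Fin d))} (x : Ω) :
    NativeSpace p Ω :=
  RKHS.kerFun (NativeSpace p Ω) x (1 : ℝ)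

lemma inner_nativeRepresenter {d : ℕ} (p : MaternParams d) {Ω : Set (EuclideanSpace ℝ (Fin d))}
    (x : Ω) (g : NativeSpace p Ω) : ⟪nativeRepresenter p x, g⟫_ℝ = g x := by
  simp [nativeRepresenter]

lemma nativeRepresenter_apply {d : ℕ} (p : MaternParams d)
    {Ω : Set (EuclideanSpace ℝ (Fin d))} (x y : Ω) :
    nativeRepresenter p y x = matern p x y := by
  rw [nativeRepresenter, RKHS.kerFun_apply, RKHS.OfKernel.kernel_ofKernel]
  simp [maternKernel]

lemma norm_sum_smul_nativeRepresenter_sq {d : ℕ} (p : MaternParams d)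
    {Ω : Set (EuclideanSpace ℝ (Fin d))} {κ : Type*} [Fintype κ] (b : κ → ℝ) (x : κ → Ω) :
    ‖∑ i, b i • nativeRepresenter p (x i)‖ ^ 2 = ∑ i, ∑ j, b i * b j * matern p (x i) (x j) := by
  rw [← real_inner_self_eq_norm_sq, sum_inner]
  refine Finset.sum_congr rfl fun i _ => ?_
  rw [inner_sum]
  refine Finset.sum_congr rfl fun j _ => ?_
  rw [real_inner_smul_left, real_inner_smul_right, inner_nativeRepresenter,
    nativeRepresenter_apply]
  ring

lemma matern_self {d : ℕ} (p : MaternParams d) (x : EuclideanSpace ℝ (Fin d)) :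
    matern p x x = p.σ ^ 2 := by
  have : diagScale p.θ 0 = 0 := by ext k; simp [diagScale]
  simp [matern, maternRadial, this]

lemma norm_nativeRepresenter_sq {d : ℕ} (p : MaternParams d) {Ω : Set (EuclideanSpace ℝ (Fin d))}
    (x : Ω) : ‖nativeRepresenter p x‖ ^ 2 = p.σ ^ 2 := by
  rw [← real_inner_self_eq_norm_sq, inner_nativeRepresenter, nativeRepresenter_apply, matern_self]

lemma exists_norm_diagScale_le {d : ℕ} (θ : Fin d → ℝ) (R : ℝ) :
    ∃ D : ℝ, 0 < D ∧ ∀ u : EuclideanSpace ℝ (Fin d), ‖u‖ ≤ R → ‖diagScale θ u‖ ^ 2 ≤ D := by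
  have hc : Continuous fun u : EuclideanSpace ℝ (Fin d) => ‖diagScale θ u‖ ^ 2 := by
    unfold diagScale
    fun_prop
  obtain ⟨D, hD⟩ := (isCompact_closedBall (0 : EuclideanSpace ℝ (Fin d)) R).bddAbove_image
    hc.continuousOn
  exact ⟨max D 1, by positivity, fun u hu =>
    (hD (mem_image_of_mem _ (by simpa using hu))).trans (le_max_left _ _)⟩

lemma exists_knot_norm_sub_le {d : ℕ} {Ω : Set (EuclideanSpace ℝ (Fin d))}
    (hΩ : Bornology.IsBounded Ω) {n : ℕ} (hn : 0 < n) (X : Fin n → Ω) (x : Ω) :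
    ∃ j, ‖(x : EuclideanSpace ℝ (Fin d)) - X j‖ ≤ fillDistance X := by
  have : Nonempty (Fin n) := ⟨⟨0, hn⟩⟩
  obtain ⟨j, hj⟩ := Finite.exists_min fun j => ‖(x : EuclideanSpace ℝ (Fin d)) - X j‖
  obtain ⟨D, hD⟩ := Metric.isBounded_iff.mp hΩ
  refine ⟨j, (le_ciInf hj).trans (le_ciSup (f := fun x : Ω =>
    ⨅ j : Fin n, ‖(x : EuclideanSpace ℝ (Fin d)) - X j‖) ⟨D, ?_⟩ x)⟩
  rintro _ ⟨y, rfl⟩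
  refine (ciInf_le (Finite.bddBelow_range _) ⟨0, hn⟩).trans ?_
  rw [← dist_eq_norm]
  exact hD y.2 (X _).2

lemma fillDistance_nonneg {d : ℕ} {Ω : Set (EuclideanSpace ℝ (Fin d))} {n : ℕ} (X : Fin n → Ω) :
    0 ≤ fillDistance X :=
  Real.iSup_nonneg fun _ => Real.iInf_nonneg fun _ => norm_nonneg _

/-- **Power function bound.** The distance in the native space from `Ψ(·, x)` to the span of the
`Ψ(·, x_j)` is `O(h^ν)`, uniformly in `x ∈ Ω`. -/
lemma exists_mem_span_norm_nativeRepresenter_sub_sq_le {d : ℕ}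
    {Ω : Set (EuclideanSpace ℝ (Fin d))} (hΩ_compact : IsCompact Ω) (hΩ_convex : Convex ℝ Ω)
    (hΩ_int : (interior Ω).Nonempty) (p : MaternParams d) :
    ∃ C : ℝ, 0 < C ∧ ∀ n : ℕ, 0 < n → ∀ (X : Fin n → Ω) (x : Ω),
      ∃ v ∈ Submodule.span ℝ (range fun j => nativeRepresenter p (X j)),
        ‖nativeRepresenter p x - v‖ ^ 2 ≤ C * fillDistance X ^ (2 * p.ν) := by
  classical
  have hν := p.ν_pos
  obtain ⟨c, hc⟩ := hΩ_int
  obtain ⟨r₀, hr₀, hball⟩ := Metric.nhds_basis_closedBall.mem_iff.mp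
    (mem_interior_iff_mem_nhds.mp hc)
  obtain ⟨R₁, hR₁⟩ := Metric.isBounded_iff.mp hΩ_compact.isBounded
  obtain ⟨m, hm⟩ := exists_nat_gt p.ν
  have hm' : p.ν < (m + 1 : ℕ) := by push_cast; linarith
  set R : ℝ := max (R₁ / r₀) 2 with hR
  obtain ⟨ι, _, y, ε, A, hy, hε, hε1, hrep⟩ := exists_polynomial_reproduction d m R
  obtain ⟨D, hD0, hD⟩ := exists_norm_diagScale_le p.θ (R + R)
  set h₀ : ℝ := r₀ * ε with hh₀
  have hh₀pos : 0 < h₀ := by positivity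
  -- `C₁` serves for `h < h₀` and comes from the annihilating weights at scale `r = h / ε`, with
  -- total mass at most `A + 1`; `C₂` serves for `h ≥ h₀`, where the zero approximant is used.
  set C₁ : ℝ := p.σ ^ 2 / Real.Gamma p.ν * (((A + 1) ^ 2 / p.ν +
    2 * (A + 1) ^ 2 / ((m + 1 : ℕ) - p.ν)) * (p.ν * D) ^ p.ν) * (ε⁻¹) ^ (2 * p.ν) with hC₁
  set C₂ : ℝ := p.σ ^ 2 * (h₀⁻¹) ^ (2 * p.ν) with hC₂
  have hC₂pos : 0 < C₂ := by
    have := p.σ_pos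
    positivity
  refine ⟨max C₁ C₂, lt_max_of_lt_right hC₂pos, fun n hn X x => ?_⟩
  have hh := fillDistance_nonneg X
  set h : ℝ := fillDistance X with hh_def
  have hknot := exists_knot_norm_sub_le hΩ_compact.isBounded hn X
  rw [← hh_def] at hknot
  rcases hh.eq_or_lt with h0 | hpos
  · -- At fill distance zero the point `x` is itself a knot.
    obtain ⟨j, hj⟩ := hknot x
    have hxj : x = X j := by
      refine Subtype.ext (sub_eq_zero.mp (norm_le_zero_iff.mp ?_))
      rwa [h0]
    refine ⟨nativeRepresenter p (X j), Submodule.subset_span (mem_range_self j), ?_⟩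
    rw [hxj, sub_self, norm_zero, zero_pow two_ne_zero]
    exact mul_nonneg (hC₂pos.le.trans (le_max_right _ _)) (Real.rpow_nonneg hh _)
  rcases le_or_gt h₀ h with hge | hlt
  · refine ⟨0, zero_mem _, ?_⟩
    rw [sub_zero, norm_nativeRepresenter_sq]
    have h1 : 1 ≤ (h₀⁻¹ * h) ^ (2 * p.ν) := by
      refine Real.one_le_rpow ?_ (by positivity)
      rw [inv_mul_eq_div, one_le_div hh₀pos]
      exact hge
    calc p.σ ^ 2 ≤ p.σ ^ 2 * (h₀⁻¹ * h) ^ (2 * p.ν) := le_mul_of_one_le_right (sq_nonneg _) h1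
      _ = C₂ * h ^ (2 * p.ν) := by
          rw [Real.mul_rpow (by positivity) hh, hC₂]; ring
      _ ≤ max C₁ C₂ * h ^ (2 * p.ν) := by
          gcongr
          exact le_max_right _ _
  · -- By convexity `Ω` contains a ball of radius `r = h / ε` whose centre `ζ` is at distance `O(r)`
    -- of `x`; there is a knot within `h = r ε` of each scaled reference point `ζ + r y_i`.
    set t : ℝ := h / h₀ with ht
    have ht0 : 0 < t := by positivity
    have ht1 : t ≤ 1 := by rw [ht, div_le_one hh₀pos]; exact hlt.le
    set r : ℝ := t * r₀ with hr
    have hr0 : 0 < r := by positivity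
    have hrh : r = ε⁻¹ * h := by rw [hr, ht, hh₀]; field_simp
    set ζ : EuclideanSpace ℝ (Fin d) := (1 - t) • (x : EuclideanSpace ℝ (Fin d)) + t • c with hζ
    have hmem : ∀ i, ζ + r • y i ∈ Ω := by
      intro i
      have h1 : c + r₀ • y i ∈ Ω := by
        refine hball ?_
        rw [mem_closedBall_iff_norm, add_sub_cancel_left, norm_smul, Real.norm_of_nonneg hr₀.le]
        exact mul_le_of_le_one_right hr₀.le (hy i)
      have h2 := hΩ_convex x.2 h1 (sub_nonneg.mpr ht1) ht0.le (by ring)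
      convert h2 using 1
      rw [hζ, hr, smul_add, smul_smul, add_assoc]
    choose J hJ using fun i => hknot ⟨_, hmem i⟩
    set z : ι → EuclideanSpace ℝ (Fin d) := fun i => r⁻¹ • ((X (J i) : EuclideanSpace ℝ (Fin d)) - ζ)
      with hz
    set w : EuclideanSpace ℝ (Fin d) := r⁻¹ • ((x : EuclideanSpace ℝ (Fin d)) - ζ) with hw
    have hzy : ∀ i, ‖z i - y i‖ ≤ ε := by
      intro i
      have : z i - y i = r⁻¹ • ((X (J i) : EuclideanSpace ℝ (Fin d)) - (ζ + r • y i)) := by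
        rw [hz, ← sub_sub, smul_sub r⁻¹ _ (r • y i), smul_smul, inv_mul_cancel₀ hr0.ne', one_smul]
      rw [this, norm_smul, norm_sub_rev, Real.norm_of_nonneg (inv_nonneg.mpr hr0.le),
        inv_mul_le_iff₀ hr0]
      refine (hJ i).trans_eq ?_
      rw [hrh]
      field_simp
    have hwR : ‖w‖ ≤ R := by
      have : w = r₀⁻¹ • ((x : EuclideanSpace ℝ (Fin d)) - c) := by
        have h1 : (x : EuclideanSpace ℝ (Fin d)) - ζ = t • ((x : EuclideanSpace ℝ (Fin d)) - c) := by
          rw [hζ, sub_smul, one_smul, smul_sub]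
          abel
        rw [hw, h1, smul_smul]
        congr 1
        rw [hr]
        field_simp
      rw [this, norm_smul, Real.norm_of_nonneg (inv_nonneg.mpr hr₀.le), inv_mul_eq_div]
      refine le_trans ?_ (le_max_left _ _)
      gcongr
      rw [← dist_eq_norm]
      exact hR₁ x.2 (interior_subset hc)
    have hzR : ∀ i, ‖z i‖ ≤ R := by
      intro i
      have h1 := norm_add_le (z i - y i) (y i)
      rw [sub_add_cancel] at h1
      have h2 : (2 : ℝ) ≤ R := le_max_right _ _
      linarith [hzy i, hy i]
    obtain ⟨a, haA, haq⟩ := hrep z hzy w hwR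
    set b : Option ι → ℝ := fun o => o.elim 1 fun i => -a i with hb
    set z' : Option ι → EuclideanSpace ℝ (Fin d) := fun o => o.elim w z with hz'
    set x' : Option ι → Ω := fun o => o.elim x fun i => X (J i) with hx'
    have hz'x : ∀ o, z' o = r⁻¹ • ((x' o : EuclideanSpace ℝ (Fin d)) - ζ) := by
      rintro (_ | i) <;> rfl
    have hz'R : ∀ o, ‖z' o‖ ≤ R := by
      rintro (_ | i)
      exacts [hwR, hzR i]
    have hmain := matern_sum_annihilator_le p hm' b z' (A := A + 1) (D := D) (r := r)
      (fun q hq => by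
        rw [Fintype.sum_option]
        simp only [hb, hz', Option.elim_none, Option.elim_some, neg_mul, Finset.sum_neg_distrib,
          one_mul]
        rw [haq q hq, add_neg_cancel])
      (by
        rw [Fintype.sum_option]
        simp only [hb, Option.elim_none, Option.elim_some, abs_neg, abs_one]
        linarith)
      (fun o o' => hD _ ((norm_sub_le _ _).trans (add_le_add (hz'R o) (hz'R o'))))
      hD0 hr0 (fun o => x' o) (fun o o' => by
        rw [hz'x, hz'x, ← smul_sub, smul_smul, mul_inv_cancel₀ hr0.ne', one_smul]
        abel)
    refine ⟨∑ i, a i • nativeRepresenter p (X (J i)), Submodule.sum_mem _ fun i _ =>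
      Submodule.smul_mem _ _ (Submodule.subset_span (mem_range_self (J i))), ?_⟩
    have hv : nativeRepresenter p x - ∑ i, a i • nativeRepresenter p (X (J i)) =
        ∑ o, b o • nativeRepresenter p (x' o) := by
      rw [Fintype.sum_option]
      simp only [hb, hx', Option.elim_none, Option.elim_some, neg_smul, Finset.sum_neg_distrib,
        one_smul, sub_eq_add_neg]
    rw [hv, norm_sum_smul_nativeRepresenter_sq]
    refine hmain.trans ?_
    rw [hrh, Real.mul_rpow (by positivity) hh, ← mul_assoc]
    gcongr
    exact le_max_left _ _

/-- Every `g` in the native space differs from a combination of the `Ψ(·, x_j)`, namely its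
interpolant at the knots, by at most `√C h^ν ‖g‖` uniformly on `Ω`. -/
lemma exists_interpolant_sub_sq_le {d : ℕ}
    {Ω : Set (EuclideanSpace ℝ (Fin d))} (hΩ_compact : IsCompact Ω) (hΩ_convex : Convex ℝ Ω)
    (hΩ_int : (interior Ω).Nonempty) (p : MaternParams d) :
    ∃ C : ℝ, 0 < C ∧ ∀ n : ℕ, 0 < n → ∀ (X : Fin n → Ω) (g : NativeSpace p Ω),
      ∃ a : Fin n → ℝ, ∀ x : Ω, (g x - ∑ j, a j * matern p x (X j)) ^ 2 ≤
        C * ‖g‖ ^ 2 * fillDistance X ^ (2 * p.ν) := by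
  obtain ⟨C, hC, hpow⟩ :=
    exists_mem_span_norm_nativeRepresenter_sub_sq_le hΩ_compact hΩ_convex hΩ_int p
  refine ⟨C, hC, fun n hn X g => ?_⟩
  set W := Submodule.span ℝ (range fun j => nativeRepresenter p (X j)) with hW
  have : FiniteDimensional ℝ W := FiniteDimensional.span_of_finite ℝ (finite_range _)
  obtain ⟨a, ha⟩ := (Submodule.mem_span_range_iff_exists_fun ℝ).mp (W.starProjection_apply_mem g)
  refine ⟨a, fun x => ?_⟩
  set e : NativeSpace p Ω := g - W.starProjection g with he
  have hex : g x - ∑ j, a j * matern p x (X j) = ⟪nativeRepresenter p x, e⟫_ℝ := by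
    rw [he, inner_sub_right, inner_nativeRepresenter, ← ha, inner_sum]
    congr 1
    refine Finset.sum_congr rfl fun j _ => ?_
    rw [real_inner_smul_right, inner_nativeRepresenter, nativeRepresenter_apply]
  obtain ⟨v, hv, hvle⟩ := hpow n hn X x
  have hev : ⟪v, e⟫_ℝ = 0 := by
    rw [he]
    exact (W.sub_starProjection_mem_orthogonal g) v hv
  have hen : ‖e‖ ≤ ‖g‖ := by
    have h1 : ⟪W.starProjection g, e⟫_ℝ = 0 :=
      (W.sub_starProjection_mem_orthogonal g) _ (W.starProjection_apply_mem g)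
    have h2 : ‖e‖ * ‖e‖ ≤ ‖g‖ * ‖e‖ := by
      rw [← real_inner_self_eq_norm_mul_norm]
      nth_rw 1 [he]
      rw [inner_sub_left, h1, sub_zero]
      exact real_inner_le_norm g e
    by_contra! hlt
    have := norm_nonneg g
    nlinarith
  have h1 : ⟪nativeRepresenter p x, e⟫_ℝ = ⟪nativeRepresenter p x - v, e⟫_ℝ := by
    rw [inner_sub_left, hev, sub_zero]
  rw [hex, h1]
  calc ⟪nativeRepresenter p x - v, e⟫_ℝ ^ 2 ≤ (‖nativeRepresenter p x - v‖ * ‖e‖) ^ 2 :=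
        sq_le_sq' (neg_le_of_abs_le (abs_real_inner_le_norm _ _)) (real_inner_le_norm _ _)
    _ = ‖nativeRepresenter p x - v‖ ^ 2 * ‖e‖ ^ 2 := mul_pow _ _ _
    _ ≤ (C * fillDistance X ^ (2 * p.ν)) * ‖g‖ ^ 2 := by
        have := (sq_nonneg _).trans hvle
        gcongr
    _ = C * ‖g‖ ^ 2 * fillDistance X ^ (2 * p.ν) := by ring

/-! ### The mean squared prediction error -/

/-- The conditional expectation is the best `L²` predictor among the `m`-measurable ones. -/
lemma integral_sub_condExp_sq_le {S : Type*} {m m₀ : MeasurableSpace S} (hm : m ≤ m₀)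
    {P : Measure S} [IsProbabilityMeasure P] {X Z : S → ℝ} (hX : MemLp X 2 P) (hZ : MemLp Z 2 P)
    (hZm : StronglyMeasurable[m] Z) :
    ∫ s, (X s - P[X | m] s) ^ 2 ∂P ≤ ∫ s, (X s - Z s) ^ 2 ∂P := by
  have hW : MemLp (X - Z) 2 P := hX.sub hZ
  have hEW : P[X - Z | m] =ᵐ[P] P[X | m] - Z := by
    have h := condExp_sub (hX.integrable one_le_two) (hZ.integrable one_le_two) m
    rwa [condExp_of_stronglyMeasurable hm hZm (hZ.integrable one_le_two)] at h
  have h1 : ∫ s, (X s - P[X | m] s) ^ 2 ∂P = ∫ s, Var[X - Z; P | m] s ∂P := by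
    rw [condVar, integral_condExp hm]
    refine integral_congr_ae ?_
    filter_upwards [hEW] with s hs
    simp only [Pi.pow_apply, Pi.sub_apply, hs]
    ring
  have h2 : ∫ s, (X s - Z s) ^ 2 ∂P = ∫ s, P[(X - Z) ^ 2 | m] s ∂P := by
    rw [integral_condExp hm]
    rfl
  rw [h1, h2]
  exact integral_mono_ae integrable_condVar integrable_condExp (condVar_ae_le_condExp_sq hm hW)

lemma continuous_matern {d : ℕ} (p : MaternParams d) :
    Continuous fun xy : EuclideanSpace ℝ (Fin d) × EuclideanSpace ℝ (Fin d) =>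
      matern p xy.1 xy.2 := by
  have hν := p.ν_pos
  have hc : Continuous fun xy : EuclideanSpace ℝ (Fin d) × EuclideanSpace ℝ (Fin d) =>
      ‖diagScale p.θ (xy.1 - xy.2)‖ := by
    unfold diagScale
    fun_prop
  simp only [matern]
  simp_rw [maternRadial_eq hν (norm_nonneg _)]
  refine continuous_const.mul (continuous_of_dominated
    (bound := fun s => Real.exp (-s) * s ^ (p.ν - 1)) (fun xy => ?_) (fun xy => ?_)
    (Real.GammaIntegral_convergent hν) ?_)
  · exact (integrableOn_gamma_gauss hν (by positivity)).aestronglyMeasurable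
  · refine (ae_restrict_mem measurableSet_Ioi).mono fun s hs => ?_
    have hs : 0 < s := hs
    rw [Real.norm_of_nonneg (by positivity), mul_comm]
    gcongr
    have : 0 ≤ p.ν * ‖diagScale p.θ (xy.1 - xy.2)‖ ^ 2 / s := by positivity
    linarith
  · refine ae_of_all _ fun s => ?_
    fun_prop

lemma abs_matern_le {d : ℕ} (p : MaternParams d) (x y : EuclideanSpace ℝ (Fin d)) :
    |matern p x y| ≤ p.σ ^ 2 := by
  set x' : (univ : Set (EuclideanSpace ℝ (Fin d))) := ⟨x, mem_univ x⟩
  set y' : (univ : Set (EuclideanSpace ℝ (Fin d))) := ⟨y, mem_univ y⟩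
  have h := abs_real_inner_le_norm (nativeRepresenter p x') (nativeRepresenter p y')
  have hn := fun z : (univ : Set (EuclideanSpace ℝ (Fin d))) =>
    (Real.sqrt_sq (norm_nonneg (nativeRepresenter p z))).symm.trans
      (by rw [norm_nativeRepresenter_sq, Real.sqrt_sq p.σ_pos.le])
  rw [inner_nativeRepresenter, nativeRepresenter_apply, hn, hn] at h
  rw [sq]
  exact h

section LinearKernel

variable {d : ℕ} {Ω : Set (EuclideanSpace ℝ (Fin d))}

lemma isFiniteMeasure_comap_volume (hΩ : IsCompact Ω) :
    IsFiniteMeasure (Measure.comap (Subtype.val : Ω → _) volume) := by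
  refine ⟨?_⟩
  rw [(MeasurableEmbedding.subtype_coe hΩ.measurableSet).comap_apply, image_univ,
    Subtype.range_coe]
  exact hΩ.measure_lt_top

lemma integrable_linearKernel (hΩ : IsCompact Ω) (p : MaternParams d) {u v : Ω → ℝ}
    (hu : Continuous u) (hv : Continuous v) :
    Integrable (fun q : Ω × Ω => u q.1 * v q.2 * matern p q.1 q.2)
      ((Measure.comap Subtype.val volume).prod (Measure.comap Subtype.val volume)) := by
  have := isFiniteMeasure_comap_volume hΩ
  have : CompactSpace Ω := isCompact_iff_compactSpace.mp hΩ
  have hι : Continuous fun q : Ω × Ω =>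
      ((q.1 : EuclideanSpace ℝ (Fin d)), (q.2 : EuclideanSpace ℝ (Fin d))) := by fun_prop
  have hm : Continuous fun q : Ω × Ω => matern p q.1 q.2 := by
    have h := (continuous_matern p).comp hι
    simpa only [Function.comp_def] using h
  have hc : Continuous fun q : Ω × Ω => u q.1 * v q.2 * matern p q.1 q.2 := by fun_prop
  exact hc.integrable_of_hasCompactSupport (HasCompactSupport.of_compactSpace _)

lemma linearKernel_eq_integral_prod (hΩ : IsCompact Ω) (p : MaternParams d) {u v : Ω → ℝ}
    (hu : Continuous u) (hv : Continuous v) :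
    linearKernel p u v = ∫ q : Ω × Ω, u q.1 * v q.2 * matern p q.1 q.2
      ∂((Measure.comap Subtype.val volume).prod (Measure.comap Subtype.val volume)) := by
  have := isFiniteMeasure_comap_volume hΩ
  rw [integral_prod _ (integrable_linearKernel hΩ p hu hv)]
  rfl

lemma sum_sum_linearKernel (hΩ : IsCompact Ω) (p : MaternParams d) {κ : Type*} [Fintype κ]
    (b : κ → ℝ) {u : κ → Ω → ℝ} (hu : ∀ i, Continuous (u i)) :
    ∑ i, ∑ j, b i * b j * linearKernel p (u i) (u j) =
      linearKernel p (fun x => ∑ i, b i * u i x) (fun x => ∑ i, b i * u i x) := by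
  have hi : ∀ i j, Integrable (fun q : Ω × Ω => b i * b j * (u i q.1 * u j q.2 *
      matern p q.1 q.2))
      ((Measure.comap Subtype.val volume).prod (Measure.comap Subtype.val volume)) := fun i j =>
    (integrable_linearKernel hΩ p (hu i) (hu j)).const_mul _
  have hc : Continuous fun x => ∑ i, b i * u i x :=
    continuous_finsetSum _ fun i _ => continuous_const.mul (hu i)
  rw [linearKernel_eq_integral_prod hΩ p hc hc]
  simp_rw [linearKernel_eq_integral_prod hΩ p (hu _) (hu _), ← integral_const_mul]
  rw [← Finset.sum_congr rfl fun i _ => integral_finsetSum _ fun j _ => hi i j,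
    ← integral_finsetSum _ fun i _ => integrable_finsetSum _ fun j _ => hi i j]
  refine integral_congr_ae (ae_of_all _ fun q => ?_)
  simp only
  rw [Finset.sum_mul_sum, Finset.sum_mul]
  refine Finset.sum_congr rfl fun i _ => ?_
  rw [Finset.sum_mul]
  exact Finset.sum_congr rfl fun j _ => by ring

lemma linearKernel_self_le (hΩ : IsCompact Ω) (p : MaternParams d) {e : Ω → ℝ}
    (he : Continuous e) {B : ℝ} (hB : ∀ x, e x ^ 2 ≤ B) :
    linearKernel p e e ≤ p.σ ^ 2 * volume.real Ω ^ 2 * B := by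
  have := isFiniteMeasure_comap_volume hΩ
  rw [linearKernel_eq_integral_prod hΩ p he he]
  refine (le_abs_self _).trans ?_
  have h := norm_integral_le_of_norm_le_const (C := B * p.σ ^ 2)
    (μ := (Measure.comap (Subtype.val : Ω → _) volume).prod (Measure.comap Subtype.val volume))
    (f := fun q : Ω × Ω => e q.1 * e q.2 * matern p q.1 q.2) (ae_of_all _ fun q => by
      rw [norm_mul, Real.norm_eq_abs, Real.norm_eq_abs]
      have h1 : |e q.1 * e q.2| ≤ B := by
        rw [abs_le]
        have := hB q.1
        have := hB q.2
        constructor <;> nlinarith [sq_nonneg (e q.1 + e q.2), sq_nonneg (e q.1 - e q.2)]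
      exact mul_le_mul h1 (abs_matern_le p _ _) (abs_nonneg _) ((abs_nonneg _).trans h1))
  refine h.trans_eq ?_
  have hv : (Measure.comap (Subtype.val : Ω → _) volume).real univ = volume.real Ω := by
    rw [measureReal_def, (MeasurableEmbedding.subtype_coe hΩ.measurableSet).comap_apply,
      image_univ, Subtype.range_coe, measureReal_def]
  rw [← univ_prod_univ, measureReal_prod_prod, hv]
  ring

/-- The mean squared prediction error is at most the mean square of `f(g) - ∑ a_j f(g_j)`, which
is `K(e, e)` with `e = g - ∑ a_j g_j`, for any coefficients `a`. -/
lemma mspe_le_of_sub_sum_sq_le (hΩ : IsCompact Ω) (p : MaternParams d) {V : Set (Ω → ℝ)}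
    (hV : ∀ v ∈ V, Continuous v) {S : Type*} [MeasurableSpace S] {P : Measure S}
    [IsProbabilityMeasure P] {f : V → S → ℝ} (hf : IsLinearFIGP p V P f) {n : ℕ} (G : Fin n → V)
    (g : V) (a : Fin n → ℝ) {B : ℝ}
    (hB : ∀ x, ((g : Ω → ℝ) x - ∑ j, a j * (G j : Ω → ℝ) x) ^ 2 ≤ B) :
    mspe P f G g ≤ p.σ ^ 2 * volume.real Ω ^ 2 * B := by
  have hL : ∀ v, MemLp (f v) 2 P := fun v => (hf.gaussian.hasGaussianLaw_eval v).memLp_two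
  set Z : S → ℝ := fun s => ∑ j, a j * f (G j) s with hZ
  have hZL : MemLp Z 2 P := memLp_finsetSum _ fun j _ => (hL (G j)).const_mul (a j)
  have hF : Measurable fun s (j : Fin n) => f (G j) s :=
    measurable_pi_lambda _ fun j => hf.measurable (G j)
  have hZm : StronglyMeasurable[MeasurableSpace.comap (fun s (j : Fin n) => f (G j) s)
      inferInstance] Z := by
    have h1 : Measurable fun v : Fin n → ℝ => ∑ j, a j * v j := by fun_prop
    exact (h1.comp (comap_measurable (fun s (j : Fin n) => f (G j) s))).stronglyMeasurable
  refine (integral_sub_condExp_sq_le hF.comap_le (hL g) hZL hZm).trans ?_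
  set b : Option (Fin n) → ℝ := fun o => o.elim 1 fun j => -a j with hb
  set u : Option (Fin n) → V := fun o => o.elim g G with hu
  have hsum : ∀ φ : V → ℝ, φ g - ∑ j, a j * φ (G j) = ∑ o, b o * φ (u o) := by
    intro φ
    rw [Fintype.sum_option]
    simp only [hb, hu, Option.elim_none, Option.elim_some, neg_mul, Finset.sum_neg_distrib,
      one_mul, sub_eq_add_neg]
  have hcov : ∀ v w : V, ∫ s, f v s * f w s ∂P = linearKernel p (v : Ω → ℝ) w := by
    intro v w
    rw [← hf.cov_eq, covariance, hf.mean_zero, hf.mean_zero]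
    simp
  have hi : ∀ o o', Integrable (fun s => b o * b o' * (f (u o) s * f (u o') s)) P := fun o o' =>
    ((hL (u o)).integrable_mul (hL (u o'))).const_mul _
  have hK : ∫ s, (f g s - Z s) ^ 2 ∂P =
      linearKernel p (fun x => ∑ o, b o * (u o : Ω → ℝ) x)
        (fun x => ∑ o, b o * (u o : Ω → ℝ) x) := by
    rw [← sum_sum_linearKernel hΩ p b (fun o => hV _ (u o).2)]
    simp_rw [← hcov, ← integral_const_mul]
    rw [← Finset.sum_congr rfl fun o _ => integral_finsetSum _ fun o' _ => hi o o',
      ← integral_finsetSum _ fun o _ => integrable_finsetSum _ fun o' _ => hi o o']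
    refine integral_congr_ae (ae_of_all _ fun s => ?_)
    simp only [hZ]
    rw [hsum fun v => f v s, sq, Finset.sum_mul_sum]
    exact Finset.sum_congr rfl fun o _ => Finset.sum_congr rfl fun o' _ => by ring
  rw [hK]
  refine linearKernel_self_le hΩ p (continuous_finsetSum _ fun o _ =>
    continuous_const.mul (hV _ (u o).2)) fun x => ?_
  exact (congrArg (· ^ 2) (hsum fun v => (v : Ω → ℝ) x)).symm.trans_le (hB x)

end LinearKernel

/-! ### Quasi-uniform designs -/

/-- Volume comparison: the balls of radius `h / c` around quasi-uniform knots are disjoint and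
contained in a fixed ball. -/
lemma fillDistance_le_of_isQuasiUniform {d : ℕ} (hd : 0 < d) {Ω : Set (EuclideanSpace ℝ (Fin d))}
    {R : ℝ} (hR0 : 0 ≤ R) (hR : ∀ x ∈ Ω, ∀ y ∈ Ω, dist x y ≤ R) {c : ℝ} (hc : 0 < c) {n : ℕ}
    (hn : 0 < n) {X : Fin n → Ω} (hX : IsQuasiUniform c X) :
    fillDistance X ≤ R * (c + 1) * (n : ℝ) ^ (-(1 / (d : ℝ))) := by
  have : Nonempty (Fin n) := ⟨⟨0, hn⟩⟩
  have : Nonempty (Fin d) := ⟨⟨0, hd⟩⟩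
  have hn' : (0 : ℝ) < n := by exact_mod_cast hn
  have hhR : fillDistance X ≤ R := by
    have : Nonempty Ω := ⟨X ⟨0, hn⟩⟩
    refine ciSup_le fun x => (ciInf_le (Finite.bddBelow_range _) ⟨0, hn⟩).trans ?_
    rw [← dist_eq_norm]
    exact hR _ x.2 _ (X _).2
  rcases (fillDistance_nonneg X).eq_or_lt with h0 | hpos
  · rw [← h0]
    positivity
  set q : ℝ := fillDistance X / c with hq
  have hq0 : 0 < q := by positivity
  have hcq : c * q = fillDistance X := by rw [hq]; field_simp
  have hdisj : Pairwise (Function.onFun Disjoint fun j =>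
      Metric.ball (X j : EuclideanSpace ℝ (Fin d)) q) := by
    intro j k hjk
    refine Metric.ball_disjoint_ball ?_
    have h1 := hX j k hjk
    rw [← hcq] at h1
    have := le_of_mul_le_mul_left h1 hc
    rw [dist_eq_norm]
    linarith
  have hsub : (⋃ j, Metric.ball (X j : EuclideanSpace ℝ (Fin d)) q) ⊆
      Metric.ball (X ⟨0, hn⟩ : EuclideanSpace ℝ (Fin d)) (R + q) := by
    refine iUnion_subset fun j => Metric.ball_subset_ball' ?_
    linarith [hR _ (X j).2 _ (X ⟨0, hn⟩).2]
  have hvol := measureReal_mono (μ := volume) hsub measure_ball_lt_top.ne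
  rw [measureReal_iUnion_fintype hdisj fun _ => measurableSet_ball] at hvol
  have hball : ∀ (x : EuclideanSpace ℝ (Fin d)) {r : ℝ}, 0 ≤ r → volume.real (Metric.ball x r) =
      r ^ d * volume.real (Metric.ball (0 : EuclideanSpace ℝ (Fin d)) 1) := by
    intro x r hr
    rw [measureReal_def, Measure.addHaar_ball _ _ hr, finrank_euclideanSpace_fin,
      ENNReal.toReal_mul, ENNReal.toReal_ofReal (by positivity), measureReal_def]
  have hunit : 0 < volume.real (Metric.ball (0 : EuclideanSpace ℝ (Fin d)) 1) :=
    ENNReal.toReal_pos (Metric.measure_ball_pos _ _ one_pos).ne' measure_ball_lt_top.ne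
  rw [Finset.sum_congr rfl fun j _ => hball (X j) hq0.le,
    hball (X ⟨0, hn⟩) (by positivity), Finset.sum_const, Finset.card_univ, Fintype.card_fin, nsmul_eq_mul,
    ← mul_assoc] at hvol
  have hpow : (n : ℝ) * q ^ d ≤ (R + q) ^ d := le_of_mul_le_mul_right hvol hunit
  have hroot : ((n : ℝ) ^ (1 / (d : ℝ)) * q) ^ d ≤ (R + q) ^ d := by
    rwa [mul_pow, ← Real.rpow_natCast (_ ^ _) d, ← Real.rpow_mul hn'.le,
      one_div_mul_cancel (by positivity), Real.rpow_one]
  have hle : (n : ℝ) ^ (1 / (d : ℝ)) * q ≤ R + q :=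
    le_of_pow_le_pow_left₀ hd.ne' (by positivity) hroot
  rw [Real.rpow_neg hn'.le, ← div_eq_mul_inv, le_div_iff₀ (by positivity), ← hcq]
  calc c * q * (n : ℝ) ^ (1 / (d : ℝ)) = c * ((n : ℝ) ^ (1 / (d : ℝ)) * q) := by ring
    _ ≤ c * (R + q) := by gcongr
    _ = R * c + fillDistance X := by rw [← hcq]; ring
    _ ≤ R * (c + 1) := by linarith

/-! ### Convergence rates -/

lemma exists_mspe_le {d : ℕ} {Ω : Set (EuclideanSpace ℝ (Fin d))}
    (hΩ_compact : IsCompact Ω) (hΩ_convex : Convex ℝ Ω) (hΩ_int : (interior Ω).Nonempty)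
    (p : MaternParams d) :
    ∃ C : ℝ, 0 < C ∧
      ∀ (n : ℕ), 0 < n → ∀ (X : Fin n → Ω)
        (V : Set (Ω → ℝ)) (_ : ∀ v ∈ V, Continuous v)
        (S : Type*) [MeasurableSpace S] (P : Measure S) [IsProbabilityMeasure P]
        (f : V → S → ℝ) (_ : IsLinearFIGP p V P f)
        (hX : ∀ j, knotInput p (X j) ∈ V) (g : NativeSpace p Ω) (hg : ⇑g ∈ V),
        mspe P f (fun j => ⟨knotInput p (X j), hX j⟩) ⟨⇑g, hg⟩ ≤
          C * ‖g‖ ^ 2 * fillDistance X ^ (2 * p.ν) := by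
  obtain ⟨C, hC, hint⟩ := exists_interpolant_sub_sq_le hΩ_compact hΩ_convex hΩ_int p
  have hvol : 0 < volume.real Ω := ENNReal.toReal_pos
    (Measure.measure_pos_of_nonempty_interior _ hΩ_int).ne' hΩ_compact.measure_lt_top.ne
  have hσ := p.σ_pos
  refine ⟨p.σ ^ 2 * volume.real Ω ^ 2 * C, by positivity,
    fun n hn X V hV S _ P _ f hf hX g hg => ?_⟩
  obtain ⟨a, ha⟩ := hint n hn X g
  have ha' : ∀ x : Ω, (g x - ∑ j, a j * knotInput p (X j) x) ^ 2 ≤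
      C * ‖g‖ ^ 2 * fillDistance X ^ (2 * p.ν) := by
    simpa only [knotInput] using ha
  have h := mspe_le_of_sub_sum_sq_le hΩ_compact p hV hf (fun j => ⟨knotInput p (X j), hX j⟩)
    ⟨⇑g, hg⟩ a ha'
  refine h.trans_eq ?_
  simp only [mul_assoc]

theorem corollary2 {d : ℕ} (hd : 0 < d) (Ω : Set (EuclideanSpace ℝ (Fin d)))
    (hΩ_compact : IsCompact Ω) (hΩ_convex : Convex ℝ Ω) (hΩ_int : (interior Ω).Nonempty)
    (p : MaternParams d) :
    -- (1) the bound through the fill distance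
    (∃ C₃ : ℝ, 0 < C₃ ∧
      ∀ (n : ℕ), 0 < n → ∀ (X : Fin n → Ω)
        (V : Set (Ω → ℝ)) (_ : ∀ v ∈ V, Continuous v)
        (S : Type*) [MeasurableSpace S] (P : Measure S) [IsProbabilityMeasure P]
        (f : V → S → ℝ) (_ : IsLinearFIGP p V P f)
        (hX : ∀ j, knotInput p (X j) ∈ V) (g : NativeSpace p Ω) (hg : ⇑g ∈ V),
        mspe P f (fun j => ⟨knotInput p (X j), hX j⟩) ⟨⇑g, hg⟩ ≤
          C₃ * ‖g‖ ^ 2 * fillDistance X ^ (2 * p.ν)) ∧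
    -- (2) the fill distance and the bound for quasi-uniform designs
    (∀ c : ℝ, 0 < c →
      (∃ C : ℝ, 0 < C ∧
        ∀ (n : ℕ), 0 < n → ∀ (X : Fin n → Ω), IsQuasiUniform c X →
          fillDistance X ≤ C * (n : ℝ) ^ (-(1 / (d : ℝ)))) ∧
      (∃ C₄ : ℝ, 0 < C₄ ∧
        ∀ (n : ℕ), 0 < n → ∀ (X : Fin n → Ω), IsQuasiUniform c X → ∀
          (V : Set (Ω → ℝ)) (_ : ∀ v ∈ V, Continuous v)
          (S : Type*) [MeasurableSpace S] (P : Measure S) [IsProbabilityMeasure P]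
          (f : V → S → ℝ) (_ : IsLinearFIGP p V P f)
          (hX : ∀ j, knotInput p (X j) ∈ V) (g : NativeSpace p Ω) (hg : ⇑g ∈ V),
          mspe P f (fun j => ⟨knotInput p (X j), hX j⟩) ⟨⇑g, hg⟩ ≤
            C₄ * ‖g‖ ^ 2 * (n : ℝ) ^ (-(2 * p.ν / (d : ℝ))))) := by
  obtain ⟨R, hR⟩ := Metric.isBounded_iff.mp hΩ_compact.isBounded
  have hrate : ∀ c : ℝ, 0 < c → ∀ n : ℕ, 0 < n → ∀ X : Fin n → Ω, IsQuasiUniform c X →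
      fillDistance X ≤ (|R| + 1) * (c + 1) * (n : ℝ) ^ (-(1 / (d : ℝ))) :=
    fun c hc n hn X hX => fillDistance_le_of_isQuasiUniform hd (by positivity)
      (fun x hx y hy => (hR hx hy).trans ((le_abs_self R).trans (by linarith))) hc hn hX
  refine ⟨exists_mspe_le hΩ_compact hΩ_convex hΩ_int p, fun c hc =>
    ⟨⟨(|R| + 1) * (c + 1), by positivity, hrate c hc⟩, ?_⟩⟩
  obtain ⟨C₃, hC₃, hmspe⟩ := exists_mspe_le hΩ_compact hΩ_convex hΩ_int p
  refine ⟨C₃ * ((|R| + 1) * (c + 1)) ^ (2 * p.ν), by positivity,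
    fun n hn X hqu V hV S _ P _ f hf hX g hg =>
      (hmspe n hn X V hV S P f hf hX g hg).trans ?_⟩
  have hν := p.ν_pos
  have hpow : fillDistance X ^ (2 * p.ν) ≤
      ((|R| + 1) * (c + 1)) ^ (2 * p.ν) * (n : ℝ) ^ (-(2 * p.ν / (d : ℝ))) := by
    refine (Real.rpow_le_rpow (fillDistance_nonneg X) (hrate c hc n hn X hqu)
      (by positivity)).trans_eq ?_
    rw [Real.mul_rpow (by positivity) (by positivity), ← Real.rpow_mul n.cast_nonneg]
    congr 2
    ring
  calc C₃ * ‖g‖ ^ 2 * fillDistance X ^ (2 * p.ν)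
      ≤ C₃ * ‖g‖ ^ 2 *
        (((|R| + 1) * (c + 1)) ^ (2 * p.ν) * (n : ℝ) ^ (-(2 * p.ν / (d : ℝ)))) := by gcongr
    _ = _ := by ring
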